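/- Let $\theta\in\mathbb R$; all algebras are over $\mathbb C$. Let $H=\mathcal O(SU(2))$ be the commutative algebra generated by $w_1,w_2,w_1^*,w_2^*$ with $w_1^*w_1+w_2^*w_2=1$, a Hopf algebra with $\Delta(W)=W\overset{.}{\otimes}W$, $\varepsilon(W)=1$, $S(W)=W^*$ for $W=\begin{pmatrix}w_1&-w_2^*\\ w_2&w_1^*\end{pmatrix}$, where $\overset{.}{\otimes}$ is the tensor product combined with matrix multiplication. Let $\mathcal O(S^7)$ be the commutative algebra generated by $z_i,z_i^*$ ($1\le i\le 4$) with $\sum_i z_i^*z_i=1$. It has the right $H$-coaction $\delta$ that is the algebra map with $\delta(u)=u\overset{.}{\otimes}W$, where $u=\begin{pmatrix}z_1&z_2&z_3&z_4\\-z_2^*&z_1^*&-z_4^*&z_3^*\end{pmatrix}^t$. Let $K=\mathcal O(\mathbb T^2)=\mathbb C[t_1^{\pm1},t_2^{\pm1}]$ with the $t_j$ group-like and $t_j^*=t_j^{-1}$. It coacts on $\mathcal O(S^7)$ from the left by the algebra map with $z_i\mapsto\tau_i\otimes z_i$, $z_i^*\mapsto\tau_i^{*}\otimes z_i^*$, where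 $(\tau_i)=(t_1,t_1^*,t_2,t_2^*)$. Let $\mathcal O(S^4)$ be the commutative algebra generated by $\alpha,\alpha^*,\beta,\beta^*,x$ with $\alpha^*\alpha+\beta^*\beta+x^2=1$ and with the left $K$-coaction given by the algebra map with $\alpha\mapsto t_1t_2^*\otimes\alpha$, $\alpha^*\mapsto t_1^*t_2\otimes\alpha^*$, $\beta\mapsto t_1^*t_2^*\otimes\beta$, $\beta^*\mapsto t_1t_2\otimes\beta^*$, $x\mapsto1\otimes x$. The $K$-equivariant algebra map $\mathcal O(S^4)\to\mathcal O(S^7)$ dual to the Hopf map is $$\alpha\mapsto 2(z_1z_3^*+z_2^*z_4),\quad \alpha^*\mapsto 2(z_1^*z_3+z_2z_4^*),\quad \beta\mapsto 2(z_2z_3^*-z_1^*z_4),\quad \beta^*\mapsto 2(z_2^*z_3-z_1z_4^*),$$ $$x\mapsto z_1z_1^*+z_2z_2^*-z_3z_3^*-z_4z_4^*.$$ Let $\sigma$ be the exponential 2-cocycle on $K$, i.e. the linear map $K\otimes K\to\mathbb C$ with $$\sigma(t_1^{m_1}t_2^{m_2}\otimes t_1^{n_1}t_2^{n_2})=\exp\Big(i\pi\sum_{j,k}m_j\Theta_{jk}n_k\Big),\qquad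 \Theta=\tfrac12\begin{pmatrix}0&\theta\\-\theta&0\end{pmatrix}.$$ For a left $K$-comodule algebra $A$, with coaction $a\mapsto a_{(-1)}\otimes a_{(0)}$, let ${}_\sigma A$ be the vector space $A$ with the product $a\bullet a'=\sigma(a_{(-1)}\otimes a'_{(-1)})\,a_{(0)}a'_{(0)}$. Set $\mathcal O(S^7_\theta)={}_\sigma\mathcal O(S^7)$, with the right $H$-coaction $\delta$ (unchanged as a linear map), and $\mathcal O(S^4_\theta)={}_\sigma\mathcal O(S^4)$. **Proposition.** The algebra $A=\mathcal O(S^7_\theta)$ is a principal $\mathcal O(SU(2))$-comodule algebra. That is, the antipode of $H$ is bijective; $\delta:A\to A\otimes H$ is a unital algebra map making $A$ a right $H$-comodule; with $B=A^{coH}=\{b\in A:\delta(b)=b\otimes1\}$ the canonical map $A\otimes_BA\to A\otimes H$, $a\otimes_B a'\mapsto a\,a'_{(0)}\otimes a'_{(1)}$, is bijective; and the multiplication $B\otimes A\to A$ has a section $A\to B\otimes A$ that is left $B$-linear and right $H$-colinear. Moreover the Hopf map above, viewed as a map $\mathcal O(S^4_\theta)\to\mathcal O(S^7_\theta)$, is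 an injective algebra map whose image is the algebra $A^{coH}$ of coinvariants. -/

import Mathlib

open scoped TensorProduct

noncomputable section

namespace QuantumHopf

/-! ### Comodule algebras -/

section Coactions

variable (k : Type*) [CommRing k]

/-- The structure of a left `K`-comodule algebra on the algebra `A`: a unital algebra map
`ρ : A → K ⊗ A` which is coassociative and counital. -/
structure LeftCoaction (K A : Type*) [Ring K] [HopfAlgebra k K] [Ring A] [Algebra k A] where
  toAlgHom : A →ₐ[k] K ⊗[k] A
  coassoc : ∀ a, TensorProduct.assoc k K K A
      (TensorProduct.map Coalgebra.comul LinearMap.id (toAlgHom a)) =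
    TensorProduct.map LinearMap.id toAlgHom.toLinearMap (toAlgHom a)
  counit : ∀ a, TensorProduct.lid k A
      (TensorProduct.map Coalgebra.counit LinearMap.id (toAlgHom a)) = a

/-- The structure of a right `H`-comodule algebra on the algebra `A`: a unital algebra map
`δ : A → A ⊗ H` which is coassociative and counital. -/
structure RightCoaction (H A : Type*) [Ring H] [HopfAlgebra k H] [Ring A] [Algebra k A] where
  toAlgHom : A →ₐ[k] A ⊗[k] H
  coassoc : ∀ a, TensorProduct.assoc k A H H
      (TensorProduct.map toAlgHom.toLinearMap LinearMap.id (toAlgHom a)) =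
    TensorProduct.map LinearMap.id Coalgebra.comul (toAlgHom a)
  counit : ∀ a, TensorProduct.rid k A
      (TensorProduct.map LinearMap.id Coalgebra.counit (toAlgHom a)) = a

end Coactions

/-! ### Coinvariants, the canonical map, principal comodule algebras -/

namespace RightCoaction

section Galois

variable {k H A : Type*} [CommRing k] [Ring H] [HopfAlgebra k H] [Ring A] [Algebra k A]

/-- The subalgebra `A^{co H} = {b | δ b = b ⊗ 1}`. -/
def coinvariants (δ : RightCoaction k H A) : Subalgebra k A :=
  AlgHom.equalizer δ.toAlgHom Algebra.TensorProduct.includeLeft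

theorem mem_coinvariants (δ : RightCoaction k H A) (b : A) :
    b ∈ δ.coinvariants ↔ δ.toAlgHom b = b ⊗ₜ[k] (1 : H) := Iff.rfl

/-- The relations `ab ⊗ c = a ⊗ bc`, `b ∈ B`, defining the tensor product over a (possibly
noncommutative) subalgebra `B`. -/
def balancedRel (B : Subalgebra k A) : Submodule k (A ⊗[k] A) :=
  Submodule.span k {x | ∃ a c : A, ∃ b ∈ B, x = (a * b) ⊗ₜ[k] c - a ⊗ₜ[k] (b * c)}

/-- The tensor product `A ⊗_B A`. -/
abbrev BalancedTensor (B : Subalgebra k A) : Type _ := (A ⊗[k] A) ⧸ balancedRel B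

/-- The map `A ⊗ A → A ⊗ H`, `a ⊗ c ↦ (a ⊗ 1) δ(c)`. -/
def preCanonical (δ : RightCoaction k H A) : A ⊗[k] A →ₗ[k] A ⊗[k] H :=
  LinearMap.mul' k (A ⊗[k] H) ∘ₗ
    TensorProduct.map (Algebra.TensorProduct.includeLeft : A →ₐ[k] A ⊗[k] H).toLinearMap
      δ.toAlgHom.toLinearMap

theorem preCanonical_tmul (δ : RightCoaction k H A) (a c : A) :
    δ.preCanonical (a ⊗ₜ[k] c) = (a ⊗ₜ[k] (1 : H)) * δ.toAlgHom c := by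
  simp [preCanonical]

theorem balancedRel_le_ker (δ : RightCoaction k H A) :
    balancedRel δ.coinvariants ≤ LinearMap.ker δ.preCanonical := by
  refine Submodule.span_le.2 ?_
  rintro _ ⟨a, c, b, hb, rfl⟩
  have hb' := (δ.mem_coinvariants b).1 hb
  simp only [SetLike.mem_coe, LinearMap.mem_ker, map_sub, preCanonical_tmul, map_mul, hb']
  rw [← mul_assoc, Algebra.TensorProduct.tmul_mul_tmul, one_mul, sub_self]

/-- The canonical map `χ : A ⊗_B A → A ⊗ H`, `a ⊗_B c ↦ a c₍₀₎ ⊗ c₍₁₎`, where `B = A^{co H}`. -/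
def canonicalMap (δ : RightCoaction k H A) :
    BalancedTensor δ.coinvariants →ₗ[k] A ⊗[k] H :=
  (balancedRel δ.coinvariants).liftQ δ.preCanonical δ.balancedRel_le_ker

/-- `B = A^{co H} ⊆ A` is an `H`-Hopf-Galois extension. -/
def IsHopfGalois (δ : RightCoaction k H A) : Prop :=
  Function.Bijective δ.canonicalMap

/-- `A` is equivariantly projective as a left `B`-module, `B = A^{co H}`: the multiplication
`B ⊗ A → A` has a section which is left `B`-linear and right `H`-colinear (`B` carries the
trivial coaction). -/
def IsEquivariantlyProjective (δ : RightCoaction k H A) : Prop :=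
  ∃ s : A →ₗ[k] δ.coinvariants ⊗[k] A,
    (∀ (b : δ.coinvariants) (a : A), s (b * a) = b • s a) ∧
    (∀ a : A, TensorProduct.assoc k δ.coinvariants A H
        (TensorProduct.map s LinearMap.id (δ.toAlgHom a)) =
      TensorProduct.map LinearMap.id δ.toAlgHom.toLinearMap (s a)) ∧
    (∀ a : A, LinearMap.mul' k A
        (TensorProduct.map δ.coinvariants.val.toLinearMap LinearMap.id (s a)) = a)

end Galois

/-- Principal `H`-comodule algebras over a field. -/
structure IsPrincipal {k H A : Type*} [Field k] [Ring H] [HopfAlgebra k H] [Ring A] [Algebra k A]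
    (δ : RightCoaction k H A) : Prop where
  antipode_bijective : Function.Bijective (HopfAlgebra.antipode k : H →ₗ[k] H)
  hopfGalois : δ.IsHopfGalois
  equivariantlyProjective : δ.IsEquivariantlyProjective

end RightCoaction

/-! ### Two-cocycles and twisted comodule algebras -/

section Twist

variable {k K A : Type*} [CommRing k] [Ring K] [HopfAlgebra k K]

/-- For `σ : K ⊗ K → k` and `ρ : A → K ⊗ A`, the map
`A ⊗ A → A`, `a ⊗ c ↦ σ(a₍₋₁₎ ⊗ c₍₋₁₎) a₍₀₎ c₍₀₎`. -/
def twistMul [Ring A] [Algebra k A] (σ : K ⊗[k] K →ₗ[k] k) (ρ : A →ₗ[k] K ⊗[k] A) :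
    A ⊗[k] A →ₗ[k] A :=
  (TensorProduct.lid k A).toLinearMap ∘ₗ TensorProduct.map σ (LinearMap.mul' k A) ∘ₗ
    (TensorProduct.tensorTensorTensorComm k K A K A).toLinearMap ∘ₗ TensorProduct.map ρ ρ

variable (k K) in
/-- A unital convolution invertible 2-cocycle on the Hopf algebra `K`. Here
`twistMul σ Δ (g ⊗ h) = σ(g₍₁₎ ⊗ h₍₁₎) g₍₂₎ h₍₂₎`, so that the last condition reads
`σ(g₍₁₎ ⊗ h₍₁₎) σ(g₍₂₎ h₍₂₎ ⊗ l) = σ(h₍₁₎ ⊗ l₍₁₎) σ(g ⊗ h₍₂₎ l₍₂₎)`. -/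
structure TwoCocycle where
  toLin : K ⊗[k] K →ₗ[k] k
  convInvertible : IsUnit (WithConv.toConv toLin)
  map_one_tmul : ∀ h : K, toLin (1 ⊗ₜ[k] h) = Coalgebra.counit h
  map_tmul_one : ∀ h : K, toLin (h ⊗ₜ[k] 1) = Coalgebra.counit h
  cocycle : ∀ g h l : K,
    toLin (twistMul toLin Coalgebra.comul (g ⊗ₜ[k] h) ⊗ₜ[k] l) =
      toLin (g ⊗ₜ[k] twistMul toLin Coalgebra.comul (h ⊗ₜ[k] l))

variable [Ring A] [Algebra k A]

/-- The algebra `A` twisted by the 2-cocycle `σ` through the left coaction `ρ`: the vector space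
`A` with product `a • c = σ(a₍₋₁₎ ⊗ c₍₋₁₎) a₍₀₎ c₍₀₎`. -/
def Twisted (_σ : TwoCocycle k K) (_ρ : LeftCoaction k K A) : Type _ := A

namespace LeftCoaction

/-- The twisted product on the underlying module, before changing the type. -/
def tmul (σ : TwoCocycle k K) (ρ : LeftCoaction k K A) : A ⊗[k] A →ₗ[k] A :=
  twistMul σ.toLin ρ.toAlgHom.toLinearMap

/-- `(k ⊗ k' ⊗ a) ⊗ (l ⊗ l' ⊗ c) ↦ σ(k ⊗ l) kl' ⊗ ac` -/
def auxL (σ : K ⊗[k] K →ₗ[k] k) (A : Type*) [Ring A] [Algebra k A] :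
    (K ⊗[k] (K ⊗[k] A)) ⊗[k] (K ⊗[k] (K ⊗[k] A)) →ₗ[k] K ⊗[k] A :=
  (TensorProduct.lid k _).toLinearMap ∘ₗ TensorProduct.map σ (LinearMap.mul' k (K ⊗[k] A)) ∘ₗ
    (TensorProduct.tensorTensorTensorComm k K (K ⊗[k] A) K (K ⊗[k] A)).toLinearMap

theorem auxL_tmul (σ : K ⊗[k] K →ₗ[k] k) (g h : K) (x y : K ⊗[k] A) :
    auxL σ A ((g ⊗ₜ[k] x) ⊗ₜ[k] (h ⊗ₜ[k] y)) = σ (g ⊗ₜ[k] h) • (x * y) := by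
  simp [auxL]

theorem coact_tmul (σ : TwoCocycle k K) (ρ : LeftCoaction k K A) (a c : A) :
    ρ.toAlgHom (ρ.tmul σ (a ⊗ₜ[k] c)) =
      TensorProduct.map (twistMul σ.toLin Coalgebra.comul) (LinearMap.mul' k A)
        (TensorProduct.tensorTensorTensorComm k K A K A (ρ.toAlgHom a ⊗ₜ[k] ρ.toAlgHom c)) := by
  have h1 : ∀ x y : K ⊗[k] A, ρ.toAlgHom (TensorProduct.lid k A (TensorProduct.map σ.toLin
      (LinearMap.mul' k A) (TensorProduct.tensorTensorTensorComm k K A K A (x ⊗ₜ[k] y)))) =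
      auxL σ.toLin A (TensorProduct.map LinearMap.id ρ.toAlgHom.toLinearMap x ⊗ₜ[k]
        TensorProduct.map LinearMap.id ρ.toAlgHom.toLinearMap y) := by
    intro x y
    induction x with
    | zero => simp
    | add x x' hx hx' => simp only [TensorProduct.add_tmul, map_add, hx, hx']
    | tmul g a =>
      induction y with
      | zero => simp
      | add y y' hy hy' => simp only [TensorProduct.tmul_add, map_add, hy, hy']
      | tmul h c => simp [auxL_tmul]
  have h2 : ∀ x y : K ⊗[k] A,
      auxL σ.toLin A (TensorProduct.assoc k K K A (TensorProduct.map Coalgebra.comul LinearMap.id x)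
        ⊗ₜ[k] TensorProduct.assoc k K K A (TensorProduct.map Coalgebra.comul LinearMap.id y)) =
      TensorProduct.map (twistMul σ.toLin Coalgebra.comul) (LinearMap.mul' k A)
        (TensorProduct.tensorTensorTensorComm k K A K A (x ⊗ₜ[k] y)) := by
    intro x y
    induction x with
    | zero => simp
    | add x x' hx hx' => simp only [TensorProduct.add_tmul, map_add, hx, hx']
    | tmul g a =>
      induction y with
      | zero => simp
      | add y y' hy hy' => simp only [TensorProduct.tmul_add, map_add, hy, hy']
      | tmul h c =>
        simp only [TensorProduct.map_tmul, LinearMap.id_apply,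
          TensorProduct.tensorTensorTensorComm_tmul, LinearMap.mul'_apply, twistMul,
          LinearMap.comp_apply, LinearEquiv.coe_coe]
        generalize (Coalgebra.comul (R := k) g) = u
        generalize (Coalgebra.comul (R := k) h) = v
        induction u with
        | zero => simp
        | add x x' hx hx' => simp only [TensorProduct.add_tmul, map_add, hx, hx']
        | tmul g1 g2 =>
          induction v with
          | zero => simp
          | add y y' hy hy' => simp only [TensorProduct.tmul_add, TensorProduct.add_tmul, map_add, hy, hy']
          | tmul h1 h2 => simp [auxL_tmul, TensorProduct.smul_tmul']
  have h3 := h1 (ρ.toAlgHom a) (ρ.toAlgHom c)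
  rw [← ρ.coassoc a, ← ρ.coassoc c, h2] at h3
  exact h3

theorem tmul_assoc (σ : TwoCocycle k K) (ρ : LeftCoaction k K A) (a b c : A) :
    ρ.tmul σ (ρ.tmul σ (a ⊗ₜ[k] b) ⊗ₜ[k] c) = ρ.tmul σ (a ⊗ₜ[k] ρ.tmul σ (b ⊗ₜ[k] c)) := by
  have key : ∀ x y z : K ⊗[k] A,
      TensorProduct.lid k A (TensorProduct.map σ.toLin (LinearMap.mul' k A)
        (TensorProduct.tensorTensorTensorComm k K A K A
          (TensorProduct.map (twistMul σ.toLin Coalgebra.comul) (LinearMap.mul' k A)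
            (TensorProduct.tensorTensorTensorComm k K A K A (x ⊗ₜ[k] y)) ⊗ₜ[k] z))) =
      TensorProduct.lid k A (TensorProduct.map σ.toLin (LinearMap.mul' k A)
        (TensorProduct.tensorTensorTensorComm k K A K A
          (x ⊗ₜ[k] TensorProduct.map (twistMul σ.toLin Coalgebra.comul) (LinearMap.mul' k A)
            (TensorProduct.tensorTensorTensorComm k K A K A (y ⊗ₜ[k] z))))) := by
    intro x y z
    induction x with
    | zero => simp
    | add x x' hx hx' => simp only [TensorProduct.add_tmul, map_add, hx, hx']
    | tmul g a =>
      induction y with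
      | zero => simp
      | add y y' hy hy' => simp only [TensorProduct.tmul_add, TensorProduct.add_tmul, map_add, hy, hy']
      | tmul h b =>
        induction z with
        | zero => simp
        | add z z' hz hz' => simp only [TensorProduct.tmul_add, map_add, hz, hz']
        | tmul l c => simp [σ.cocycle, mul_assoc]
  have h := key (ρ.toAlgHom a) (ρ.toAlgHom b) (ρ.toAlgHom c)
  rw [← coact_tmul, ← coact_tmul] at h
  exact h

theorem one_tmul (σ : TwoCocycle k K) (ρ : LeftCoaction k K A) (a : A) :
    ρ.tmul σ (1 ⊗ₜ[k] a) = a := by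
  have h : ∀ x : K ⊗[k] A, TensorProduct.lid k A (TensorProduct.map σ.toLin (LinearMap.mul' k A)
      (TensorProduct.tensorTensorTensorComm k K A K A ((1 : K ⊗[k] A) ⊗ₜ[k] x))) =
      TensorProduct.lid k A (TensorProduct.map Coalgebra.counit LinearMap.id x) := by
    intro x
    induction x with
    | zero => simp
    | add x x' hx hx' => simp only [TensorProduct.tmul_add, map_add, hx, hx']
    | tmul g a => simp [Algebra.TensorProduct.one_def, σ.map_one_tmul]
  have := h (ρ.toAlgHom a)
  rw [ρ.counit, ← map_one ρ.toAlgHom] at this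
  exact this

theorem tmul_one (σ : TwoCocycle k K) (ρ : LeftCoaction k K A) (a : A) :
    ρ.tmul σ (a ⊗ₜ[k] 1) = a := by
  have h : ∀ x : K ⊗[k] A, TensorProduct.lid k A (TensorProduct.map σ.toLin (LinearMap.mul' k A)
      (TensorProduct.tensorTensorTensorComm k K A K A (x ⊗ₜ[k] (1 : K ⊗[k] A)))) =
      TensorProduct.lid k A (TensorProduct.map Coalgebra.counit LinearMap.id x) := by
    intro x
    induction x with
    | zero => simp
    | add x x' hx hx' => simp only [TensorProduct.add_tmul, map_add, hx, hx']
    | tmul g a => simp [Algebra.TensorProduct.one_def, σ.map_tmul_one]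
  have := h (ρ.toAlgHom a)
  rw [ρ.counit, ← map_one ρ.toAlgHom] at this
  exact this

end LeftCoaction

namespace Twisted

variable (σ : TwoCocycle k K) (ρ : LeftCoaction k K A)

instance : AddCommGroup (Twisted σ ρ) := inferInstanceAs (AddCommGroup A)

instance instModule : Module k (Twisted σ ρ) := inferInstanceAs (Module k A)

/-- The identity map of the underlying vector space of `A`, as a map from `A` to the twisted
algebra. -/
def of : A ≃ₗ[k] Twisted σ ρ := LinearEquiv.refl k A

instance : Mul (Twisted σ ρ) :=
  ⟨fun a c => of σ ρ (ρ.tmul σ ((of σ ρ).symm a ⊗ₜ[k] (of σ ρ).symm c))⟩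

instance : One (Twisted σ ρ) := ⟨of σ ρ 1⟩

theorem mul_def (a c : Twisted σ ρ) :
    a * c = of σ ρ (ρ.tmul σ ((of σ ρ).symm a ⊗ₜ[k] (of σ ρ).symm c)) := rfl

theorem one_def : (1 : Twisted σ ρ) = of σ ρ 1 := rfl

instance : Ring (Twisted σ ρ) :=
  { (inferInstance : AddCommGroup (Twisted σ ρ)), (inferInstance : Mul (Twisted σ ρ)),
    (inferInstance : One (Twisted σ ρ)) with
    left_distrib := fun a b c => by simp [mul_def, TensorProduct.tmul_add]
    right_distrib := fun a b c => by simp [mul_def, TensorProduct.add_tmul]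
    zero_mul := fun a => by simp [mul_def]
    mul_zero := fun a => by simp [mul_def]
    mul_assoc := fun a b c => by simp [mul_def, LeftCoaction.tmul_assoc]
    one_mul := fun a => by simp [mul_def, one_def, LeftCoaction.one_tmul]
    mul_one := fun a => by simp [mul_def, one_def, LeftCoaction.tmul_one] }

instance : Algebra k (Twisted σ ρ) :=
  Algebra.ofModule
    (fun r a c => by simp [mul_def, ← TensorProduct.smul_tmul'])
    (fun r a c => by simp [mul_def])

theorem of_mul_of (a c : A) : of σ ρ a * of σ ρ c = of σ ρ (ρ.tmul σ (a ⊗ₜ[k] c)) := rfl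

end Twisted

end Twist

/-! ### Twisting bicomodule algebras and maps -/

section Bicomodule

variable {k K H A : Type*} [CommRing k] [Ring K] [HopfAlgebra k K] [Ring H] [HopfAlgebra k H]
  [Ring A] [Algebra k A]

/-- Compatibility `(ρ ⊗ id) ∘ δ = (id ⊗ δ) ∘ ρ` of a left and a right coaction. -/
def IsBicomodule (ρ : LeftCoaction k K A) (δ : RightCoaction k H A) : Prop :=
  ∀ a, TensorProduct.assoc k K A H
      (TensorProduct.map ρ.toAlgHom.toLinearMap LinearMap.id (δ.toAlgHom a)) =
    TensorProduct.map LinearMap.id δ.toAlgHom.toLinearMap (ρ.toAlgHom a)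

/-- The map `(g ⊗ x) ⊗ (h ⊗ y) ↦ σ(g ⊗ h) xy`. -/
def auxB (σ : K ⊗[k] K →ₗ[k] k) (B : Type*) [Ring B] [Algebra k B] :
    (K ⊗[k] B) ⊗[k] (K ⊗[k] B) →ₗ[k] B :=
  (TensorProduct.lid k _).toLinearMap ∘ₗ TensorProduct.map σ (LinearMap.mul' k B) ∘ₗ
    (TensorProduct.tensorTensorTensorComm k K B K B).toLinearMap

theorem auxB_tmul {B : Type*} [Ring B] [Algebra k B]
    (σ : K ⊗[k] K →ₗ[k] k) (g h : K) (x y : B) :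
    auxB σ B ((g ⊗ₜ[k] x) ⊗ₜ[k] (h ⊗ₜ[k] y)) = σ (g ⊗ₜ[k] h) • (x * y) := by
  simp [auxB]

theorem tmul_eq (σ : TwoCocycle k K) (ρ : LeftCoaction k K A) (a c : A) :
    ρ.tmul σ (a ⊗ₜ[k] c) = auxB σ.toLin A (ρ.toAlgHom a ⊗ₜ[k] ρ.toAlgHom c) := rfl

/-- A map `f : A → A'` of algebras intertwining the left coactions, as a map of twisted algebras. -/
def Twisted.map {A' : Type*} [Ring A'] [Algebra k A'] (σ : TwoCocycle k K)
    (ρ : LeftCoaction k K A) (ρ' : LeftCoaction k K A') (f : A →ₐ[k] A')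
    (hf : ∀ a, ρ'.toAlgHom (f a) = TensorProduct.map LinearMap.id f.toLinearMap (ρ.toAlgHom a)) :
    Twisted σ ρ →ₐ[k] Twisted σ ρ' :=
  AlgHom.ofLinearMap
    ((Twisted.of σ ρ').toLinearMap ∘ₗ f.toLinearMap ∘ₗ (Twisted.of σ ρ).symm.toLinearMap)
    (by simp [Twisted.one_def])
    (by
      have h : ∀ x y : K ⊗[k] A, f (auxB σ.toLin A (x ⊗ₜ[k] y)) = auxB σ.toLin A'
          (TensorProduct.map LinearMap.id f.toLinearMap x ⊗ₜ[k]
            TensorProduct.map LinearMap.id f.toLinearMap y) := by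
        intro x y
        induction x with
        | zero => simp
        | add x x' hx hx' => simp only [TensorProduct.add_tmul, map_add, hx, hx']
        | tmul g a =>
          induction y with
          | zero => simp
          | add y y' hy hy' => simp only [TensorProduct.tmul_add, map_add, hy, hy']
          | tmul h c => simp [auxB_tmul]
      intro a c
      obtain ⟨a, rfl⟩ := (Twisted.of σ ρ).surjective a
      obtain ⟨c, rfl⟩ := (Twisted.of σ ρ).surjective c
      simp only [Twisted.of_mul_of, LinearMap.comp_apply, LinearEquiv.coe_coe,
        LinearEquiv.symm_apply_apply, AlgHom.toLinearMap_apply, tmul_eq, h, hf])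

theorem Twisted.map_of {A' : Type*} [Ring A'] [Algebra k A'] (σ : TwoCocycle k K)
    (ρ : LeftCoaction k K A) (ρ' : LeftCoaction k K A') (f : A →ₐ[k] A')
    (hf : ∀ a, ρ'.toAlgHom (f a) = TensorProduct.map LinearMap.id f.toLinearMap (ρ.toAlgHom a))
    (a : A) : Twisted.map σ ρ ρ' f hf (Twisted.of σ ρ a) = Twisted.of σ ρ' (f a) := rfl

/-- The right coaction on the twisted algebra of a bicomodule algebra; as a linear map it is the
original coaction. -/
def RightCoaction.twistAlgHom (σ : TwoCocycle k K) (ρ : LeftCoaction k K A)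
    (δ : RightCoaction k H A) (hρδ : IsBicomodule ρ δ) :
    Twisted σ ρ →ₐ[k] Twisted σ ρ ⊗[k] H :=
  AlgHom.ofLinearMap
    (TensorProduct.map (Twisted.of σ ρ).toLinearMap LinearMap.id ∘ₗ δ.toAlgHom.toLinearMap ∘ₗ
      (Twisted.of σ ρ).symm.toLinearMap)
    (by simp [Twisted.one_def, Algebra.TensorProduct.one_def])
    (by
      have h1 : ∀ x y : K ⊗[k] A, δ.toAlgHom (auxB σ.toLin A (x ⊗ₜ[k] y)) =
          auxB σ.toLin (A ⊗[k] H)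
          (TensorProduct.map LinearMap.id δ.toAlgHom.toLinearMap x ⊗ₜ[k]
            TensorProduct.map LinearMap.id δ.toAlgHom.toLinearMap y) := by
        intro x y
        induction x with
        | zero => simp
        | add x x' hx hx' => simp only [TensorProduct.add_tmul, map_add, hx, hx']
        | tmul g a =>
          induction y with
          | zero => simp
          | add y y' hy hy' => simp only [TensorProduct.tmul_add, map_add, hy, hy']
          | tmul h c => simp [auxB_tmul]
      have h2 : ∀ x y : A ⊗[k] H,
          TensorProduct.map (Twisted.of σ ρ).toLinearMap LinearMap.id
            (auxB σ.toLin (A ⊗[k] H)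
              (TensorProduct.assoc k K A H
                (TensorProduct.map ρ.toAlgHom.toLinearMap LinearMap.id x) ⊗ₜ[k]
              TensorProduct.assoc k K A H
                (TensorProduct.map ρ.toAlgHom.toLinearMap LinearMap.id y))) =
          TensorProduct.map (Twisted.of σ ρ).toLinearMap LinearMap.id x *
            TensorProduct.map (Twisted.of σ ρ).toLinearMap LinearMap.id y := by
        intro x y
        induction x with
        | zero => simp
        | add x x' hx hx' => simp only [TensorProduct.add_tmul, map_add, hx, hx', add_mul]
        | tmul a g =>
          induction y with
          | zero => simp
          | add y y' hy hy' => simp only [TensorProduct.tmul_add, map_add, hy, hy', mul_add]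
          | tmul c h =>
            simp only [TensorProduct.map_tmul, LinearMap.id_apply, LinearEquiv.coe_coe,
              Algebra.TensorProduct.tmul_mul_tmul, Twisted.of_mul_of, tmul_eq,
              AlgHom.toLinearMap_apply]
            generalize ρ.toAlgHom a = u
            generalize ρ.toAlgHom c = v
            induction u with
            | zero => simp
            | add x x' hx hx' => simp only [TensorProduct.add_tmul, map_add, hx, hx']
            | tmul g1 g2 =>
              induction v with
              | zero => simp
              | add y y' hy hy' =>
                simp only [TensorProduct.tmul_add, TensorProduct.add_tmul, map_add, hy, hy']
              | tmul h1 h2 => simp [auxB_tmul, TensorProduct.smul_tmul']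
      intro a c
      obtain ⟨a, rfl⟩ := (Twisted.of σ ρ).surjective a
      obtain ⟨c, rfl⟩ := (Twisted.of σ ρ).surjective c
      simp only [Twisted.of_mul_of, LinearMap.comp_apply, LinearEquiv.coe_coe,
        LinearEquiv.symm_apply_apply, AlgHom.toLinearMap_apply, tmul_eq, h1, ← hρδ _, h2])

theorem RightCoaction.twistAlgHom_of (σ : TwoCocycle k K) (ρ : LeftCoaction k K A)
    (δ : RightCoaction k H A) (hρδ : IsBicomodule ρ δ) (a : A) :
    δ.twistAlgHom σ ρ hρδ (Twisted.of σ ρ a) =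
      TensorProduct.map (Twisted.of σ ρ).toLinearMap LinearMap.id (δ.toAlgHom a) := rfl

theorem RightCoaction.twist_coassoc (σ : TwoCocycle k K) (ρ : LeftCoaction k K A)
    (δ : RightCoaction k H A) (hρδ : IsBicomodule ρ δ) (a : Twisted σ ρ) :
    TensorProduct.assoc k (Twisted σ ρ) H H
      (TensorProduct.map (δ.twistAlgHom σ ρ hρδ).toLinearMap LinearMap.id
        (δ.twistAlgHom σ ρ hρδ a)) =
    TensorProduct.map LinearMap.id Coalgebra.comul (δ.twistAlgHom σ ρ hρδ a) := by
  have h : ∀ x : A ⊗[k] H, TensorProduct.assoc k (Twisted σ ρ) H H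
      (TensorProduct.map (δ.twistAlgHom σ ρ hρδ).toLinearMap LinearMap.id
        (TensorProduct.map (Twisted.of σ ρ).toLinearMap LinearMap.id x)) =
      TensorProduct.map (Twisted.of σ ρ).toLinearMap LinearMap.id
        (TensorProduct.assoc k A H H
          (TensorProduct.map δ.toAlgHom.toLinearMap LinearMap.id x)) := by
    intro x
    induction x with
    | zero => simp
    | add x x' hx hx' => simp only [map_add, hx, hx']
    | tmul a g =>
      simp only [TensorProduct.map_tmul, LinearMap.id_apply, LinearEquiv.coe_coe,
        AlgHom.toLinearMap_apply, RightCoaction.twistAlgHom_of]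
      generalize δ.toAlgHom a = u
      induction u with
      | zero => simp
      | add x x' hx hx' => simp only [TensorProduct.add_tmul, map_add, hx, hx']
      | tmul a h => simp
  have h2 : ∀ u : A ⊗[k] H, TensorProduct.map (Twisted.of σ ρ).toLinearMap LinearMap.id
      (TensorProduct.map LinearMap.id (Coalgebra.comul (R := k) (A := H)) u) =
      TensorProduct.map LinearMap.id Coalgebra.comul
        (TensorProduct.map (Twisted.of σ ρ).toLinearMap LinearMap.id u) := by
    intro u
    induction u with
    | zero => simp
    | add x x' hx hx' => simp only [map_add, hx, hx']
    | tmul a h => simp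
  obtain ⟨a, rfl⟩ := (Twisted.of σ ρ).surjective a
  rw [RightCoaction.twistAlgHom_of, h, δ.coassoc, h2]

theorem RightCoaction.twist_counit (σ : TwoCocycle k K) (ρ : LeftCoaction k K A)
    (δ : RightCoaction k H A) (hρδ : IsBicomodule ρ δ) (a : Twisted σ ρ) :
    TensorProduct.rid k (Twisted σ ρ) (TensorProduct.map LinearMap.id Coalgebra.counit
      (δ.twistAlgHom σ ρ hρδ a)) = a := by
  have h : ∀ x : A ⊗[k] H, TensorProduct.rid k (Twisted σ ρ)
      (TensorProduct.map LinearMap.id Coalgebra.counit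
        (TensorProduct.map (Twisted.of σ ρ).toLinearMap LinearMap.id x)) =
      Twisted.of σ ρ (TensorProduct.rid k A
        (TensorProduct.map LinearMap.id Coalgebra.counit x)) := by
    intro x
    induction x with
    | zero => simp
    | add x x' hx hx' => simp only [map_add, hx, hx']
    | tmul a g => simp
  obtain ⟨a, rfl⟩ := (Twisted.of σ ρ).surjective a
  rw [RightCoaction.twistAlgHom_of, h, δ.counit]

/-- The right `H`-comodule algebra structure on the twisted algebra of a bicomodule algebra. -/
def RightCoaction.twist (σ : TwoCocycle k K) (ρ : LeftCoaction k K A) (δ : RightCoaction k H A)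
    (hρδ : IsBicomodule ρ δ) : RightCoaction k H (Twisted σ ρ) where
  toAlgHom := δ.twistAlgHom σ ρ hρδ
  coassoc := δ.twist_coassoc σ ρ hρδ
  counit := δ.twist_counit σ ρ hρδ

theorem RightCoaction.twist_of (σ : TwoCocycle k K) (ρ : LeftCoaction k K A)
    (δ : RightCoaction k H A) (hρδ : IsBicomodule ρ δ) (a : A) :
    (δ.twist σ ρ hρδ).toAlgHom (Twisted.of σ ρ a) =
      TensorProduct.map (Twisted.of σ ρ).toLinearMap LinearMap.id (δ.toAlgHom a) := rfl

end Bicomodule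

/-! ### The coordinate algebras of spheres and the Hopf algebra `O(SU(2))` -/

/-- The commutative complex algebra with generators `z_i, z_i^*`, `i < n`, and the relation
`∑ z_i^* z_i = 1`. For `n = 4` it is `O(S^7)`, for `n = 2` the algebra `O(SU(2))`. -/
def OSphere (n : ℕ) : Type :=
  MvPolynomial (Fin n ⊕ Fin n) ℂ ⧸ Ideal.span
    {∑ i : Fin n, MvPolynomial.X (Sum.inr i) * MvPolynomial.X (Sum.inl i) -
      (1 : MvPolynomial (Fin n ⊕ Fin n) ℂ)}

namespace OSphere

instance (n : ℕ) : CommRing (OSphere n) :=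
  inferInstanceAs (CommRing (MvPolynomial (Fin n ⊕ Fin n) ℂ ⧸ Ideal.span
    {∑ i : Fin n, MvPolynomial.X (Sum.inr i) * MvPolynomial.X (Sum.inl i) -
      (1 : MvPolynomial (Fin n ⊕ Fin n) ℂ)}))

instance (n : ℕ) : Algebra ℂ (OSphere n) :=
  inferInstanceAs (Algebra ℂ (MvPolynomial (Fin n ⊕ Fin n) ℂ ⧸ Ideal.span
    {∑ i : Fin n, MvPolynomial.X (Sum.inr i) * MvPolynomial.X (Sum.inl i) -
      (1 : MvPolynomial (Fin n ⊕ Fin n) ℂ)}))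

/-- The quotient map from the polynomial algebra. -/
def mk (n : ℕ) : MvPolynomial (Fin n ⊕ Fin n) ℂ →ₐ[ℂ] OSphere n :=
  Ideal.Quotient.mkₐ ℂ (Ideal.span
    {∑ i : Fin n, MvPolynomial.X (Sum.inr i) * MvPolynomial.X (Sum.inl i) -
      (1 : MvPolynomial (Fin n ⊕ Fin n) ℂ)})

variable {n : ℕ}

/-- The generator `z_i`. -/
def z (i : Fin n) : OSphere n := mk n (MvPolynomial.X (Sum.inl i))

/-- The generator `z_i^*`. -/
def zs (i : Fin n) : OSphere n := mk n (MvPolynomial.X (Sum.inr i))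

theorem sphere_relation : ∑ i : Fin n, zs i * z i = 1 := by
  have h : mk n (∑ i : Fin n, MvPolynomial.X (Sum.inr i) * MvPolynomial.X (Sum.inl i) - 1) = 0 :=
    Ideal.Quotient.eq_zero_iff_mem.2 (Ideal.subset_span rfl)
  rw [map_sub, sub_eq_zero, map_one, map_sum] at h
  simp only [map_mul] at h
  exact h

/-- The universal property of `OSphere n` among commutative algebras. -/
def lift {R : Type*} [CommRing R] [Algebra ℂ R] (f g : Fin n → R) (h : ∑ i, g i * f i = 1) :
    OSphere n →ₐ[ℂ] R :=
  Ideal.Quotient.liftₐ _ (MvPolynomial.aeval (Sum.elim f g)) (by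
    intro a ha
    rw [← RingHom.mem_ker]
    refine (Ideal.span_le (I := RingHom.ker (MvPolynomial.aeval (Sum.elim f g) :
      MvPolynomial (Fin n ⊕ Fin n) ℂ →ₐ[ℂ] R))).2 ?_ ha
    rintro _ rfl
    simp [RingHom.mem_ker, h])

section lift

variable {R : Type*} [CommRing R] [Algebra ℂ R] (f g : Fin n → R) (h : ∑ i, g i * f i = 1)

@[simp] theorem lift_z (i : Fin n) : lift f g h (z i) = f i := by
  change MvPolynomial.aeval (Sum.elim f g) (MvPolynomial.X (Sum.inl i)) = f i
  simp

@[simp] theorem lift_zs (i : Fin n) : lift f g h (zs i) = g i := by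
  change MvPolynomial.aeval (Sum.elim f g) (MvPolynomial.X (Sum.inr i)) = g i
  simp

end lift

theorem algHom_ext {R : Type*} [Semiring R] [Algebra ℂ R] {φ ψ : OSphere n →ₐ[ℂ] R}
    (h : ∀ i, φ (z i) = ψ (z i)) (hs : ∀ i, φ (zs i) = ψ (zs i)) : φ = ψ := by
  refine Ideal.Quotient.algHom_ext ℂ (MvPolynomial.algHom_ext ?_)
  rintro (i | i)
  · exact h i
  · exact hs i

end OSphere

open OSphere

/-- The algebra `O(SU(2))`; its generators `w_1, w_2, w_1^*, w_2^*` are `z 0, z 1, zs 0, zs 1`. -/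
abbrev OSU2 : Type := OSphere 2

/-- The algebra `O(S^7)`; its generators `z_1, …, z_4` are `z 0, …, z 3`. -/
abbrev OS7 : Type := OSphere 4

/-- The matrix with rows `(w_1, -w_2^*)` and `(w_2, w_1^*)`. -/
def matW : Matrix (Fin 2) (Fin 2) OSU2 := !![z 0, -zs 1; z 1, zs 0]

/-- The `4 × 2` matrix with rows `(z_1, -z_2^*)`, `(z_2, z_1^*)`, `(z_3, -z_4^*)`, `(z_4, z_3^*)`. -/
def matU : Matrix (Fin 4) (Fin 2) OS7 := !![z 0, -zs 1; z 1, zs 0; z 2, -zs 3; z 3, zs 2]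

namespace OSU2

theorem rel : (zs 0 : OSU2) * z 0 + zs 1 * z 1 = 1 := by
  simpa [Fin.sum_univ_two] using sphere_relation (n := 2)

/-- The coproduct, `Δ(W) = W ⊗ W`. -/
def comulHom : OSU2 →ₐ[ℂ] OSU2 ⊗[ℂ] OSU2 :=
  OSphere.lift
    ![z 0 ⊗ₜ z 0 - zs 1 ⊗ₜ z 1, z 1 ⊗ₜ z 0 + zs 0 ⊗ₜ z 1]
    ![zs 0 ⊗ₜ zs 0 - z 1 ⊗ₜ zs 1, zs 1 ⊗ₜ zs 0 + z 0 ⊗ₜ zs 1]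
    (by
      have h : (1 : OSU2 ⊗[ℂ] OSU2) =
          (zs 0 * z 0 + zs 1 * z 1) ⊗ₜ (zs 0 * z 0 + zs 1 * z 1) := by
        rw [rel]; rfl
      rw [h]
      simp only [Fin.sum_univ_two, Matrix.cons_val_zero, Matrix.cons_val_one, add_mul, mul_add,
        sub_mul, mul_sub, Algebra.TensorProduct.tmul_mul_tmul, TensorProduct.add_tmul,
        TensorProduct.tmul_add]
      simp only [mul_comm (z _ : OSU2) (zs _), mul_comm (z 1 : OSU2) (z 0),
        mul_comm (zs 1 : OSU2) (zs 0)]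
      abel)

/-- The counit, `ε(W) = 1`. -/
def counitHom : OSU2 →ₐ[ℂ] ℂ :=
  OSphere.lift ![1, 0] ![1, 0] (by simp)

/-- The antipode, `S(W) = W^*`. -/
def antipodeHom : OSU2 →ₐ[ℂ] OSU2 :=
  OSphere.lift ![zs 0, -z 1] ![z 0, -zs 1] (by
    rw [← rel]; simp [Fin.sum_univ_two, mul_comm])

instance instBialgebra : Bialgebra ℂ OSU2 :=
  Bialgebra.ofAlgHom comulHom counitHom
    (by
      apply OSphere.algHom_ext <;> intro i <;> fin_cases i <;>
        simp [comulHom, TensorProduct.add_tmul, TensorProduct.tmul_add, TensorProduct.sub_tmul,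
          TensorProduct.tmul_sub] <;> abel)
    (by
      apply OSphere.algHom_ext <;> intro i <;> fin_cases i <;>
        simp [comulHom, counitHom])
    (by
      apply OSphere.algHom_ext <;> intro i <;> fin_cases i <;>
        simp [comulHom, counitHom])

instance instHopfAlgebra : HopfAlgebra ℂ OSU2 :=
  HopfAlgebra.ofAlgHom antipodeHom
    (by
      have h := rel
      apply OSphere.algHom_ext <;> intro i <;> fin_cases i <;>
        simp [Bialgebra.comulAlgHom, Bialgebra.counitAlgHom, Coalgebra.comul, Coalgebra.counit,
          comulHom, counitHom, antipodeHom, Algebra.ofId_apply] <;>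
        first | ring1 | linear_combination h)
    (by
      have h := rel
      apply OSphere.algHom_ext <;> intro i <;> fin_cases i <;>
        simp [Bialgebra.comulAlgHom, Bialgebra.counitAlgHom, Coalgebra.comul, Coalgebra.counit,
          comulHom, counitHom, antipodeHom, Algebra.ofId_apply] <;>
        first | ring1 | linear_combination h)

theorem comul_matW (i j : Fin 2) :
    Coalgebra.comul (R := ℂ) (matW i j) = ∑ l, matW i l ⊗ₜ[ℂ] matW l j := by
  change comulHom (matW i j) = _
  fin_cases i <;> fin_cases j <;>
    simp [matW, comulHom, Fin.sum_univ_two, TensorProduct.tmul_neg, TensorProduct.neg_tmul] <;> abel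

theorem counit_matW (i j : Fin 2) :
    Coalgebra.counit (R := ℂ) (matW i j) = (1 : Matrix (Fin 2) (Fin 2) ℂ) i j := by
  change counitHom (matW i j) = _
  fin_cases i <;> fin_cases j <;> simp [matW, counitHom]

end OSU2

/-! ### The right coaction of `O(SU(2))` on `O(S^7)` -/

/-- The right coaction `δ(u) = u ⊗ W` on `O(S^7)`, as a map of algebras. -/
def deltaHom : OS7 →ₐ[ℂ] OS7 ⊗[ℂ] OSU2 :=
  OSphere.lift
    ![z 0 ⊗ₜ z 0 - zs 1 ⊗ₜ z 1, z 1 ⊗ₜ z 0 + zs 0 ⊗ₜ z 1,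
      z 2 ⊗ₜ z 0 - zs 3 ⊗ₜ z 1, z 3 ⊗ₜ z 0 + zs 2 ⊗ₜ z 1]
    ![zs 0 ⊗ₜ zs 0 - z 1 ⊗ₜ zs 1, zs 1 ⊗ₜ zs 0 + z 0 ⊗ₜ zs 1,
      zs 2 ⊗ₜ zs 0 - z 3 ⊗ₜ zs 1, zs 3 ⊗ₜ zs 0 + z 2 ⊗ₜ zs 1]
    (by
      have h7 : (zs 0 : OS7) * z 0 + zs 1 * z 1 + zs 2 * z 2 + zs 3 * z 3 = 1 := by
        simpa [Fin.sum_univ_four] using sphere_relation (n := 4)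
      have h : (1 : OS7 ⊗[ℂ] OSU2) =
          (zs 0 * z 0 + zs 1 * z 1 + zs 2 * z 2 + zs 3 * z 3) ⊗ₜ
            (zs 0 * z 0 + zs 1 * z 1) := by
        rw [OSU2.rel, h7]; rfl
      rw [h]
      simp only [Fin.sum_univ_four, Matrix.cons_val_zero, Matrix.cons_val_one, Matrix.cons_val,
        add_mul, mul_add,
        sub_mul, mul_sub, Algebra.TensorProduct.tmul_mul_tmul, TensorProduct.add_tmul,
        TensorProduct.tmul_add]
      simp only [mul_comm (z _ : OS7) (zs _), mul_comm (z 1 : OS7) (z 0), mul_comm (z 3 : OS7) (z 2),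
        mul_comm (zs 1 : OS7) (zs 0), mul_comm (zs 3 : OS7) (zs 2)]
      abel)

theorem deltaHom_matU (i : Fin 4) (j : Fin 2) :
    deltaHom (matU i j) = ∑ l, matU i l ⊗ₜ[ℂ] matW l j := by
  fin_cases i <;> fin_cases j <;>
    simp [matU, matW, deltaHom, Fin.sum_univ_two, TensorProduct.tmul_neg,
      TensorProduct.neg_tmul] <;> abel

/-- The right `O(SU(2))`-comodule algebra `O(S^7)`. -/
def delta : RightCoaction ℂ OSU2 OS7 where
  toAlgHom := deltaHom
  coassoc := by
    have h : (Algebra.TensorProduct.assoc ℂ ℂ ℂ OS7 OSU2 OSU2).toAlgHom.comp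
        ((Algebra.TensorProduct.map deltaHom (.id ℂ OSU2)).comp deltaHom) =
        (Algebra.TensorProduct.map (.id ℂ OS7) OSU2.comulHom).comp deltaHom := by
      apply OSphere.algHom_ext <;> intro i <;> fin_cases i <;>
        simp [deltaHom, OSU2.comulHom, TensorProduct.add_tmul, TensorProduct.tmul_add,
          TensorProduct.sub_tmul, TensorProduct.tmul_sub] <;> abel
    exact fun a => DFunLike.congr_fun h a
  counit := by
    have h : (Algebra.TensorProduct.rid ℂ ℂ OS7).toAlgHom.comp
        ((Algebra.TensorProduct.map (.id ℂ OS7) OSU2.counitHom).comp deltaHom) =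
        .id ℂ OS7 := by
      apply OSphere.algHom_ext <;> intro i <;> fin_cases i <;>
        simp [deltaHom, OSU2.counitHom]
    exact fun a => DFunLike.congr_fun h a

/-! ### The torus and its exponential 2-cocycle -/

/-- The Hopf algebra `O(T^2)`, that is, the group algebra of `ℤ²`. -/
abbrev OT2 : Type := AddMonoidAlgebra ℂ (Fin 2 → ℤ)

/-- The group-like element `t_1 ^ m_1 t_2 ^ m_2`. -/
def tor (m : Fin 2 → ℤ) : OT2 := AddMonoidAlgebra.single m 1

theorem tor_mul (m n : Fin 2 → ℤ) : tor m * tor n = tor (m + n) := by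
  simp [tor, AddMonoidAlgebra.single_mul_single]

theorem tor_zero : tor 0 = 1 := rfl

theorem comul_tor (m : Fin 2 → ℤ) : Coalgebra.comul (R := ℂ) (tor m) = tor m ⊗ₜ[ℂ] tor m := by
  simp [tor]

theorem counit_tor (m : Fin 2 → ℤ) : Coalgebra.counit (R := ℂ) (tor m) = 1 := by
  simp [tor]

theorem antipode_tor (m : Fin 2 → ℤ) : HopfAlgebra.antipode ℂ (tor m) = tor (-m) := by
  simp [tor]

theorem linearMap_ext_tor {M : Type*} [AddCommMonoid M] [Module ℂ M] {f g : OT2 →ₗ[ℂ] M}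
    (h : ∀ m, f (tor m) = g (tor m)) : f = g := by
  ext m
  simpa [tor] using h m

/-- The matrix `Θ`. -/
def Theta (θ : ℝ) : Matrix (Fin 2) (Fin 2) ℝ := (1 / 2 : ℝ) • !![0, θ; -θ, 0]

/-- `exp(i π ∑ m_j Θ_{jk} n_k)` -/
def expTheta (θ : ℝ) (m n : Fin 2 → ℤ) : ℂ :=
  Complex.exp (Complex.I * Real.pi * ∑ j, ∑ l, (m j : ℂ) * (Theta θ j l : ℂ) * (n l : ℂ))

/-- The linear map `σ : O(T^2) ⊗ O(T^2) → ℂ` with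
`σ(t^m ⊗ t^n) = exp(i π ∑ m_j Θ_{jk} n_k)`. -/
def sigmaLin (θ : ℝ) : OT2 ⊗[ℂ] OT2 →ₗ[ℂ] ℂ :=
  TensorProduct.lift
    (Finsupp.linearCombination ℂ (fun m : Fin 2 → ℤ =>
      Finsupp.linearCombination ℂ (fun n : Fin 2 → ℤ => expTheta θ m n) ∘ₗ
        (AddMonoidAlgebra.coeffLinearEquiv ℂ).toLinearMap) ∘ₗ
      (AddMonoidAlgebra.coeffLinearEquiv ℂ).toLinearMap)

theorem sigmaLin_tor (θ : ℝ) (m n : Fin 2 → ℤ) :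
    sigmaLin θ (tor m ⊗ₜ[ℂ] tor n) = expTheta θ m n := by
  simp [sigmaLin, tor]

theorem expTheta_add_left (θ : ℝ) (m m' n : Fin 2 → ℤ) :
    expTheta θ (m + m') n = expTheta θ m n * expTheta θ m' n := by
  simp only [expTheta, ← Complex.exp_add, Fin.sum_univ_two, Pi.add_apply, Int.cast_add]
  ring_nf

theorem expTheta_add_right (θ : ℝ) (m n n' : Fin 2 → ℤ) :
    expTheta θ m (n + n') = expTheta θ m n * expTheta θ m n' := by
  simp only [expTheta, ← Complex.exp_add, Fin.sum_univ_two, Pi.add_apply, Int.cast_add]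
  ring_nf

theorem expTheta_zero_left (θ : ℝ) (n : Fin 2 → ℤ) : expTheta θ 0 n = 1 := by simp [expTheta]

theorem expTheta_zero_right (θ : ℝ) (n : Fin 2 → ℤ) : expTheta θ n 0 = 1 := by simp [expTheta]

theorem expTheta_neg (θ : ℝ) (m n : Fin 2 → ℤ) : expTheta θ m n * expTheta (-θ) m n = 1 := by
  simp only [expTheta, ← Complex.exp_add, Fin.sum_univ_two]
  rw [Complex.exp_eq_one_iff]
  exact ⟨0, by simp [Theta]; ring⟩

/-- On the generators, `σ(t_j ⊗ t_k) = exp(i π Θ_{jk})`. -/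
theorem sigmaLin_generators (θ : ℝ) (j l : Fin 2) :
    sigmaLin θ (tor (Pi.single j 1) ⊗ₜ[ℂ] tor (Pi.single l 1)) =
      Complex.exp (Complex.I * Real.pi * (Theta θ j l : ℂ)) := by
  rw [sigmaLin_tor, expTheta]
  fin_cases j <;> fin_cases l <;> simp [Fin.sum_univ_two]

/-- `σ(ab ⊗ c) = σ(a ⊗ c₍₁₎) σ(b ⊗ c₍₂₎)` -/
theorem sigmaLin_mul_left (θ : ℝ) (a b c : OT2) :
    sigmaLin θ ((a * b) ⊗ₜ[ℂ] c) =
      LinearMap.mul' ℂ ℂ (TensorProduct.map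
        (sigmaLin θ ∘ₗ TensorProduct.mk ℂ OT2 OT2 a) (sigmaLin θ ∘ₗ TensorProduct.mk ℂ OT2 OT2 b)
        (Coalgebra.comul c)) := by
  suffices h : (TensorProduct.mk ℂ OT2 OT2).compr₂ (sigmaLin θ) ∘ₗ LinearMap.mul' ℂ OT2 =
      TensorProduct.lift (LinearMap.mk₂ ℂ (fun a b => LinearMap.mul' ℂ ℂ ∘ₗ TensorProduct.map
        (sigmaLin θ ∘ₗ TensorProduct.mk ℂ OT2 OT2 a)
        (sigmaLin θ ∘ₗ TensorProduct.mk ℂ OT2 OT2 b) ∘ₗ Coalgebra.comul)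
        (fun a a' b => by
          simp [LinearMap.comp_add, LinearMap.add_comp, TensorProduct.map_add_left])
        (fun r a b => by
          simp [LinearMap.comp_smul, LinearMap.smul_comp, TensorProduct.map_smul_left])
        (fun a b b' => by
          simp [LinearMap.comp_add, LinearMap.add_comp, TensorProduct.map_add_right])
        (fun r a b => by
          simp [LinearMap.comp_smul, LinearMap.smul_comp, TensorProduct.map_smul_right])) by
    simpa using congr($h (a ⊗ₜ b) c)
  apply TensorProduct.ext
  apply linearMap_ext_tor; intro m
  apply linearMap_ext_tor; intro n
  apply linearMap_ext_tor; intro l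
  simp [tor_mul, sigmaLin_tor, comul_tor, expTheta_add_left]

/-- `σ(a ⊗ bc) = σ(a₍₁₎ ⊗ c) σ(a₍₂₎ ⊗ b)` -/
theorem sigmaLin_mul_right (θ : ℝ) (a b c : OT2) :
    sigmaLin θ (a ⊗ₜ[ℂ] (b * c)) =
      LinearMap.mul' ℂ ℂ (TensorProduct.map
        (sigmaLin θ ∘ₗ (TensorProduct.mk ℂ OT2 OT2).flip c)
        (sigmaLin θ ∘ₗ (TensorProduct.mk ℂ OT2 OT2).flip b)
        (Coalgebra.comul a)) := by
  suffices h : (TensorProduct.mk ℂ OT2 OT2).flip.compr₂ (sigmaLin θ) ∘ₗ LinearMap.mul' ℂ OT2 =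
      TensorProduct.lift (LinearMap.mk₂ ℂ (fun b c => LinearMap.mul' ℂ ℂ ∘ₗ TensorProduct.map
        (sigmaLin θ ∘ₗ (TensorProduct.mk ℂ OT2 OT2).flip c)
        (sigmaLin θ ∘ₗ (TensorProduct.mk ℂ OT2 OT2).flip b) ∘ₗ Coalgebra.comul)
        (fun a a' b => by
          simp [LinearMap.comp_add, LinearMap.add_comp, TensorProduct.map_add_right])
        (fun r a b => by
          simp [LinearMap.comp_smul, LinearMap.smul_comp, TensorProduct.map_smul_right])
        (fun a b b' => by
          simp [LinearMap.comp_add, LinearMap.add_comp, TensorProduct.map_add_left])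
        (fun r a b => by
          simp [LinearMap.comp_smul, LinearMap.smul_comp, TensorProduct.map_smul_left])) by
    simpa using congr($h (b ⊗ₜ c) a)
  apply TensorProduct.ext
  apply linearMap_ext_tor; intro m
  apply linearMap_ext_tor; intro n
  apply linearMap_ext_tor; intro l
  simp [tor_mul, sigmaLin_tor, comul_tor, expTheta_add_right, mul_comm]

theorem twistMul_tor (θ : ℝ) (m n : Fin 2 → ℤ) :
    twistMul (sigmaLin θ) Coalgebra.comul (tor m ⊗ₜ[ℂ] tor n) =
      expTheta θ m n • tor (m + n) := by
  simp [twistMul, comul_tor, sigmaLin_tor, tor_mul]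

theorem sigmaLin_conv (θ : ℝ) :
    WithConv.toConv (sigmaLin θ) * WithConv.toConv (sigmaLin (-θ)) = 1 := by
  apply WithConv.ofConv_injective
  apply TensorProduct.ext
  apply linearMap_ext_tor; intro m
  apply linearMap_ext_tor; intro n
  simp [LinearMap.convMul_def, LinearMap.convOne_def, comul_tor, counit_tor, sigmaLin_tor,
    expTheta_neg]

/-- The exponential 2-cocycle on `O(T^2)`. -/
def sigma (θ : ℝ) : TwoCocycle ℂ OT2 where
  toLin := sigmaLin θ
  convInvertible := ⟨⟨WithConv.toConv (sigmaLin θ), WithConv.toConv (sigmaLin (-θ)),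
    sigmaLin_conv θ, by simpa using sigmaLin_conv (-θ)⟩, rfl⟩
  map_one_tmul := by
    suffices h : sigmaLin θ ∘ₗ TensorProduct.mk ℂ OT2 OT2 1 = Coalgebra.counit from
      fun a => DFunLike.congr_fun h a
    apply linearMap_ext_tor; intro m
    rw [counit_tor, ← tor_zero]
    simp [sigmaLin_tor, expTheta_zero_left]
  map_tmul_one := by
    suffices h : sigmaLin θ ∘ₗ (TensorProduct.mk ℂ OT2 OT2).flip 1 = Coalgebra.counit from
      fun a => DFunLike.congr_fun h a
    apply linearMap_ext_tor; intro m
    rw [counit_tor, ← tor_zero]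
    simp [sigmaLin_tor, expTheta_zero_right]
  cocycle := by
    suffices h : sigmaLin θ ∘ₗ TensorProduct.map
          (twistMul (sigmaLin θ) Coalgebra.comul) LinearMap.id =
        sigmaLin θ ∘ₗ TensorProduct.map LinearMap.id (twistMul (sigmaLin θ) Coalgebra.comul) ∘ₗ
          (TensorProduct.assoc ℂ OT2 OT2 OT2).toLinearMap from
      fun a b c => DFunLike.congr_fun h ((a ⊗ₜ b) ⊗ₜ c)
    apply TensorProduct.ext
    apply TensorProduct.ext
    apply linearMap_ext_tor; intro m
    apply linearMap_ext_tor; intro n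
    apply linearMap_ext_tor; intro l
    simp [twistMul_tor, sigmaLin_tor, expTheta_add_left, expTheta_add_right,
      ← TensorProduct.smul_tmul']
    ring

/-! ### The left coaction of the torus on `O(S^7)` -/

/-- The map of algebras `O(S^{2n-1}) → O(T^2) ⊗ O(S^{2n-1})`, `z_i ↦ t^{τ_i} ⊗ z_i`,
`z_i^* ↦ t^{-τ_i} ⊗ z_i^*`. -/
def rhoHom {n : ℕ} (τ : Fin n → Fin 2 → ℤ) : OSphere n →ₐ[ℂ] OT2 ⊗[ℂ] OSphere n :=
  OSphere.lift (fun i => tor (τ i) ⊗ₜ z i) (fun i => tor (-τ i) ⊗ₜ zs i) (by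
    simp [tor_mul, tor_zero, ← TensorProduct.tmul_sum, sphere_relation,
      Algebra.TensorProduct.one_def])

/-- The weights `(τ_1, …, τ_4) = (t_1, t_1^*, t_2, t_2^*)`. -/
def weights : Fin 4 → Fin 2 → ℤ := ![![1, 0], ![-1, 0], ![0, 1], ![0, -1]]

/-- The left `O(T^2)`-comodule algebra `O(S^7)`. -/
def rho : LeftCoaction ℂ OT2 OS7 where
  toAlgHom := rhoHom weights
  coassoc := by
    have h : (Algebra.TensorProduct.assoc ℂ ℂ ℂ OT2 OT2 OS7).toAlgHom.comp
        ((Algebra.TensorProduct.map (Bialgebra.comulAlgHom ℂ OT2) (.id ℂ OS7)).comp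
          (rhoHom weights)) =
        (Algebra.TensorProduct.map (.id ℂ OT2) (rhoHom weights)).comp (rhoHom weights) := by
      apply OSphere.algHom_ext <;> intro i <;> simp [rhoHom, comul_tor]
    exact fun a => DFunLike.congr_fun h a
  counit := by
    have h : (Algebra.TensorProduct.lid ℂ OS7).toAlgHom.comp
        ((Algebra.TensorProduct.map (Bialgebra.counitAlgHom ℂ OT2) (.id ℂ OS7)).comp
          (rhoHom weights)) = .id ℂ OS7 := by
      apply OSphere.algHom_ext <;> intro i <;> simp [rhoHom, counit_tor]
    exact fun a => DFunLike.congr_fun h a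

theorem isBicomodule : IsBicomodule rho delta := by
  have h : (Algebra.TensorProduct.assoc ℂ ℂ ℂ OT2 OS7 OSU2).toAlgHom.comp
      ((Algebra.TensorProduct.map (rhoHom weights) (.id ℂ OSU2)).comp deltaHom) =
      (Algebra.TensorProduct.map (.id ℂ OT2) deltaHom).comp (rhoHom weights) := by
    apply OSphere.algHom_ext <;> intro i <;> fin_cases i <;>
      simp [rhoHom, deltaHom, weights, TensorProduct.tmul_add, TensorProduct.tmul_sub]
  exact fun a => DFunLike.congr_fun h a

/-! ### The four-sphere -/

/-- Names of the generators of `O(S^4)`. -/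
inductive S4Gen : Type
  | α | αs | β | βs | x

/-- The defining polynomial `α^* α + β^* β + x^2 - 1`. -/
def s4Poly : MvPolynomial S4Gen ℂ :=
  MvPolynomial.X .αs * MvPolynomial.X .α + MvPolynomial.X .βs * MvPolynomial.X .β +
    MvPolynomial.X .x ^ 2 - 1

/-- The algebra `O(S^4)`: the commutative complex algebra with generators `α, α^*, β, β^*, x`
and the relation `α^* α + β^* β + x^2 = 1`. -/
def OS4 : Type := MvPolynomial S4Gen ℂ ⧸ Ideal.span {s4Poly}

namespace OS4

instance : CommRing OS4 := inferInstanceAs (CommRing (MvPolynomial S4Gen ℂ ⧸ Ideal.span {s4Poly}))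

instance : Algebra ℂ OS4 :=
  inferInstanceAs (Algebra ℂ (MvPolynomial S4Gen ℂ ⧸ Ideal.span {s4Poly}))

/-- The quotient map from the polynomial algebra. -/
def mk : MvPolynomial S4Gen ℂ →ₐ[ℂ] OS4 := Ideal.Quotient.mkₐ ℂ (Ideal.span {s4Poly})

/-- The generators. -/
def gen (i : S4Gen) : OS4 := mk (MvPolynomial.X i)

theorem relation : gen .αs * gen .α + gen .βs * gen .β + gen .x ^ 2 = 1 := by
  have h : mk s4Poly = 0 := Ideal.Quotient.eq_zero_iff_mem.2 (Ideal.subset_span rfl)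
  rw [s4Poly, map_sub, sub_eq_zero, map_one] at h
  simp only [map_mul, map_add, map_pow] at h
  exact h

/-- The universal property of `O(S^4)` among commutative algebras. -/
def lift {R : Type*} [CommRing R] [Algebra ℂ R] (f : S4Gen → R)
    (h : f .αs * f .α + f .βs * f .β + f .x ^ 2 = 1) : OS4 →ₐ[ℂ] R :=
  Ideal.Quotient.liftₐ _ (MvPolynomial.aeval f) (by
    intro a ha
    rw [← RingHom.mem_ker]
    refine (Ideal.span_le (I := RingHom.ker (MvPolynomial.aeval f :
      MvPolynomial S4Gen ℂ →ₐ[ℂ] R))).2 ?_ ha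
    rintro _ rfl
    simp [RingHom.mem_ker, s4Poly, h])

@[simp] theorem lift_gen {R : Type*} [CommRing R] [Algebra ℂ R] (f : S4Gen → R)
    (h : f .αs * f .α + f .βs * f .β + f .x ^ 2 = 1) (i : S4Gen) : lift f h (gen i) = f i := by
  change MvPolynomial.aeval f (MvPolynomial.X i) = f i
  simp

theorem algHom_ext {R : Type*} [Semiring R] [Algebra ℂ R] {φ ψ : OS4 →ₐ[ℂ] R}
    (h : ∀ i, φ (gen i) = ψ (gen i)) : φ = ψ :=
  Ideal.Quotient.algHom_ext ℂ (MvPolynomial.algHom_ext h)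

/-- The weights of the torus action on `S^4`. -/
def weight : S4Gen → Fin 2 → ℤ
  | .α => ![1, -1]
  | .αs => ![-1, 1]
  | .β => ![-1, -1]
  | .βs => ![1, 1]
  | .x => 0

/-- The map of algebras `O(S^4) → O(T^2) ⊗ O(S^4)`, `α ↦ t_1 t_2^* ⊗ α`, `β ↦ t_1^* t_2^* ⊗ β`,
`x ↦ 1 ⊗ x`. -/
def rhoHom : OS4 →ₐ[ℂ] OT2 ⊗[ℂ] OS4 :=
  lift (fun i => tor (weight i) ⊗ₜ gen i) (by
    have h1 : (![-1, 1] : Fin 2 → ℤ) + ![1, -1] = 0 := by ext i; fin_cases i <;> rfl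
    have h2 : (![1, 1] : Fin 2 → ℤ) + ![-1, -1] = 0 := by ext i; fin_cases i <;> rfl
    simp only [weight, Algebra.TensorProduct.tmul_mul_tmul, Algebra.TensorProduct.tmul_pow, tor_mul, h1, h2,
      tor_zero, one_pow]
    rw [← TensorProduct.tmul_add, ← TensorProduct.tmul_add, relation,
      Algebra.TensorProduct.one_def])

/-- The left `O(T^2)`-comodule algebra `O(S^4)`. -/
def rho : LeftCoaction ℂ OT2 OS4 where
  toAlgHom := rhoHom
  coassoc := by
    have h : (Algebra.TensorProduct.assoc ℂ ℂ ℂ OT2 OT2 OS4).toAlgHom.comp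
        ((Algebra.TensorProduct.map (Bialgebra.comulAlgHom ℂ OT2) (.id ℂ OS4)).comp rhoHom) =
        (Algebra.TensorProduct.map (.id ℂ OT2) rhoHom).comp rhoHom := by
      apply algHom_ext; intro i; simp [rhoHom, comul_tor]
    exact fun a => DFunLike.congr_fun h a
  counit := by
    have h : (Algebra.TensorProduct.lid ℂ OS4).toAlgHom.comp
        ((Algebra.TensorProduct.map (Bialgebra.counitAlgHom ℂ OT2) (.id ℂ OS4)).comp rhoHom) =
          .id ℂ OS4 := by
      apply algHom_ext; intro i; simp [rhoHom, counit_tor]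
    exact fun a => DFunLike.congr_fun h a

/-- The images in `O(S^7)` of the generators of `O(S^4)`. -/
def hopfGen : S4Gen → OS7
  | .α => 2 * (z 0 * zs 2 + zs 1 * z 3)
  | .αs => 2 * (zs 0 * z 2 + z 1 * zs 3)
  | .β => 2 * (z 1 * zs 2 - zs 0 * z 3)
  | .βs => 2 * (zs 1 * z 2 - z 0 * zs 3)
  | .x => z 0 * zs 0 + z 1 * zs 1 - z 2 * zs 2 - z 3 * zs 3

/-- The map of algebras `O(S^4) → O(S^7)` dual to the Hopf map `S^7 → S^4`. -/
def hopf : OS4 →ₐ[ℂ] OS7 :=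
  lift hopfGen (by
    have h7 : (zs 0 : OS7) * z 0 + zs 1 * z 1 + zs 2 * z 2 + zs 3 * z 3 = 1 := by
      simpa [Fin.sum_univ_four] using sphere_relation (n := 4)
    simp only [hopfGen]
    linear_combination (zs 0 * z 0 + zs 1 * z 1 + zs 2 * z 2 + zs 3 * z 3 + 1 : OS7) * h7)

theorem hopf_equivariant (a : OS4) :
    QuantumHopf.rho.toAlgHom (hopf a) =
      TensorProduct.map LinearMap.id hopf.toLinearMap (rho.toAlgHom a) := by
  have h : (QuantumHopf.rhoHom weights).comp hopf =
      (Algebra.TensorProduct.map (.id ℂ OT2) hopf).comp rhoHom := by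
    apply algHom_ext
    intro i
    have h0 : tor ![0, 0] = 1 := by
      rw [← tor_zero]; congr 1; ext i; fin_cases i <;> rfl
    cases i <;>
      simp [hopf, hopfGen, QuantumHopf.rhoHom, rhoHom, weight, weights, tor_mul, tor_zero,
        TensorProduct.tmul_add, TensorProduct.tmul_sub, two_mul, h0]
  exact DFunLike.congr_fun h a

end OS4

/-! ### The quantum Hopf bundle -/

/-- The algebra `O(S^7_θ)`: the twist of `O(S^7)` by the exponential cocycle. -/
abbrev OS7θ (θ : ℝ) : Type := Twisted (sigma θ) rho

/-- The algebra `O(S^4_θ)`: the twist of `O(S^4)` by the exponential cocycle. -/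
abbrev OS4θ (θ : ℝ) : Type := Twisted (sigma θ) OS4.rho

/-- The right `O(SU(2))`-comodule algebra `O(S^7_θ)`. -/
def deltaθ (θ : ℝ) : RightCoaction ℂ OSU2 (OS7θ θ) := delta.twist (sigma θ) rho isBicomodule

/-- The algebra map `O(S^4_θ) → O(S^7_θ)`, equal to the Hopf map `O(S^4) → O(S^7)` on the
underlying vector spaces. -/
def hopfθ (θ : ℝ) : OS4θ θ →ₐ[ℂ] OS7θ θ :=
  Twisted.map (sigma θ) OS4.rho rho OS4.hopf OS4.hopf_equivariant

end QuantumHopf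

end

/-! Principality comes from a strong connection `ℓ : H → A ⊗ A`. Given one, `a ⊗ h ↦ a ℓ(h)` inverts
the canonical map, and `a ↦ a₍₀₎ ℓ(a₍₁₎)` takes values in `B ⊗ A` and splits the multiplication
equivariantly (`isHopfGalois`, `isEquivariantlyProjective`). No commutativity of `A` is used there.

For `O(S^7)` the natural candidate is `W ↦ u^* ⊗ u`. Its multiplicative extension does not respect
the relation of `O(SU(2))` inside `A ⊗ A`, so `pairing` is defined only on the free polynomial
algebra `Poly 2`. A linear section `O(SU(2)) → Poly 2`, colinear on both sides, repairs this: each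
function on the sphere has a unique harmonic polynomial representative (`harmonic_bijective`, the
Fischer decomposition), and the Laplace operator commutes with both regular coactions because these
preserve the quadratic form dual to it (`polyRight_laplacian`, `polyLeft_laplacian`). The connection
is `pairing` after this harmonic lift.

The same linear map is a strong connection after twisting. Colinearity does not involve the product
of `A`, and `ℓ` takes values in sums of tensors of opposite torus weights, on which the cocycle is
`1` because `Θ` is antisymmetric (`tmul_connection`).

Twisting changes neither the vector spaces nor the linear maps `δ` and the Hopf map, so injectivity
and the image can be treated classically. Where `(1 + x) / 2` or `(1 - x) / 2` is inverted, the Hopf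
map has a section, and an `SU(2)`-valued translation moves the generic point of `S^7` into that
section. This gives both assertions up to a power of the inverted function (`chart`). The two
functions sum to `1`, so their powers are coprime and the local statements glue (`hopf_injective`,
`exists_hopf_eq`). -/

noncomputable section

namespace QuantumHopf

namespace RightCoaction

/-! ### Strong connections imply the Hopf-Galois property and equivariant projectivity. -/

section StrongConnection

variable {k H A : Type*} [Field k] [Ring H] [HopfAlgebra k H] [Ring A] [Algebra k A]

/-- A strong connection `ℓ : H → A ⊗ A`, `ℓ(h) = h⁽¹⁾ ⊗ h⁽²⁾`: it satisfies `h⁽¹⁾ h⁽²⁾ = ε(h)`,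
is right colinear, and is left colinear for the left coaction `a ↦ S⁻¹(a₍₁₎) ⊗ a₍₀₎`; the last
condition is written as `δ(h⁽¹⁾) ⊗ h⁽²⁾ = h₍₂₎⁽¹⁾ ⊗ S(h₍₁₎) ⊗ h₍₂₎⁽²⁾`. -/
structure IsStrongConnection (δ : RightCoaction k H A) (ℓ : H →ₗ[k] A ⊗[k] A) : Prop where
  mul : ∀ h, LinearMap.mul' k A (ℓ h) = algebraMap k A (Coalgebra.counit h)
  right : ∀ h, TensorProduct.map LinearMap.id δ.toAlgHom.toLinearMap (ℓ h) =
    TensorProduct.assoc k A A H (TensorProduct.map ℓ LinearMap.id (Coalgebra.comul h))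
  left : ∀ h, TensorProduct.map δ.toAlgHom.toLinearMap LinearMap.id (ℓ h) =
    TensorProduct.map (TensorProduct.comm k H A).toLinearMap LinearMap.id
      ((TensorProduct.assoc k H A A).symm
        (TensorProduct.map (HopfAlgebra.antipode k) ℓ (Coalgebra.comul h)))

/-- The map `A ⊗ H → A ⊗ A`, `a ⊗ h ↦ a ℓ(h)`. -/
def connectionLift (ℓ : H →ₗ[k] A ⊗[k] A) : A ⊗[k] H →ₗ[k] A ⊗[k] A :=
  LinearMap.mul' k (A ⊗[k] A) ∘ₗ
    TensorProduct.map (Algebra.TensorProduct.includeLeft : A →ₐ[k] A ⊗[k] A).toLinearMap ℓ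

theorem connectionLift_tmul (ℓ : H →ₗ[k] A ⊗[k] A) (a : A) (h : H) :
    connectionLift ℓ (a ⊗ₜ[k] h) = (a ⊗ₜ[k] (1 : A)) * ℓ h := by
  simp [connectionLift]

theorem connectionLift_mul (ℓ : H →ₗ[k] A ⊗[k] A) (a : A) (x : A ⊗[k] H) :
    connectionLift ℓ ((a ⊗ₜ[k] (1 : H)) * x) = (a ⊗ₜ[k] (1 : A)) * connectionLift ℓ x := by
  induction x with
  | zero => simp
  | add x y hx hy => simp only [mul_add, map_add, hx, hy]
  | tmul c h =>
    rw [Algebra.TensorProduct.tmul_mul_tmul, one_mul, connectionLift_tmul, connectionLift_tmul,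
      ← mul_assoc, Algebra.TensorProduct.tmul_mul_tmul, one_mul]

/-- This form exposes `id ⊗ δ`, so that right colinearity of a connection can be substituted
directly. -/
theorem preCanonical_eq (δ : RightCoaction k H A) (y : A ⊗[k] A) :
    δ.preCanonical y = TensorProduct.map (LinearMap.mul' k A) LinearMap.id
      ((TensorProduct.assoc k A A H).symm
        (TensorProduct.map LinearMap.id δ.toAlgHom.toLinearMap y)) := by
  induction y with
  | zero => simp
  | add x y hx hy => simp only [map_add, hx, hy]
  | tmul a c =>
    rw [preCanonical_tmul, TensorProduct.map_tmul, AlgHom.toLinearMap_apply]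
    generalize δ.toAlgHom c = u
    induction u with
    | zero => simp
    | add x y hx hy => simp only [TensorProduct.tmul_add, map_add, mul_add, hx, hy]
    | tmul d h => simp

theorem preCanonical_mul (δ : RightCoaction k H A) (a : A) (y : A ⊗[k] A) :
    δ.preCanonical ((a ⊗ₜ[k] (1 : A)) * y) = (a ⊗ₜ[k] (1 : H)) * δ.preCanonical y := by
  induction y with
  | zero => simp
  | add x y hx hy => simp only [mul_add, map_add, hx, hy]
  | tmul c d =>
    rw [Algebra.TensorProduct.tmul_mul_tmul, one_mul, preCanonical_tmul, preCanonical_tmul,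
      ← mul_assoc, Algebra.TensorProduct.tmul_mul_tmul, one_mul]

theorem map_includeLeft_mul (a : A) (x : A ⊗[k] A) :
    TensorProduct.map (Algebra.TensorProduct.includeLeft : A →ₐ[k] A ⊗[k] H).toLinearMap
        LinearMap.id ((a ⊗ₜ[k] (1 : A)) * x) =
      ((a ⊗ₜ[k] (1 : H)) ⊗ₜ[k] (1 : A)) *
        TensorProduct.map (Algebra.TensorProduct.includeLeft : A →ₐ[k] A ⊗[k] H).toLinearMap
          LinearMap.id x := by
  induction x with
  | zero => simp
  | add x y hx hy => simp only [mul_add, map_add, hx, hy]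
  | tmul c d => simp

theorem map_coaction_mul (δ : RightCoaction k H A) (a : A) (x : A ⊗[k] A) :
    TensorProduct.map δ.toAlgHom.toLinearMap LinearMap.id ((a ⊗ₜ[k] (1 : A)) * x) =
      (δ.toAlgHom a ⊗ₜ[k] (1 : A)) *
        TensorProduct.map δ.toAlgHom.toLinearMap LinearMap.id x := by
  induction x with
  | zero => simp
  | add x y hx hy => simp only [mul_add, map_add, hx, hy]
  | tmul c d => simp

theorem mem_coinvariants_iff_ker (δ : RightCoaction k H A) (b : A) :
    b ∈ δ.coinvariants ↔ (δ.toAlgHom.toLinearMap -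
      (Algebra.TensorProduct.includeLeft : A →ₐ[k] A ⊗[k] H).toLinearMap) b = 0 := by
  rw [mem_coinvariants, LinearMap.sub_apply, sub_eq_zero]
  rfl

/-- Coinvariants are a kernel; tensoring with a flat module then identifies `B ⊗ A` inside `A ⊗ A`
by an equation on the first leg. -/
theorem exact_coinvariants (δ : RightCoaction k H A) :
    Function.Exact δ.coinvariants.val.toLinearMap (δ.toAlgHom.toLinearMap -
      (Algebra.TensorProduct.includeLeft : A →ₐ[k] A ⊗[k] H).toLinearMap) := by
  intro b
  rw [← mem_coinvariants_iff_ker]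
  simp

theorem map_val_injective (δ : RightCoaction k H A) (M : Type*) [AddCommGroup M] [Module k M] :
    Function.Injective (TensorProduct.map δ.coinvariants.val.toLinearMap
      (LinearMap.id : M →ₗ[k] M)) :=
  Module.Flat.rTensor_preserves_injective_linearMap (M := M) _ Subtype.val_injective

variable {δ : RightCoaction k H A} {ℓ : H →ₗ[k] A ⊗[k] A}

namespace IsStrongConnection

/-- Right colinearity gives `h₍₁₎⁽¹⁾ h₍₁₎⁽²⁾ ⊗ h₍₂₎`, which is `ε(h₍₁₎) ⊗ h₍₂₎` by the normalization
of `ℓ`. -/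
theorem preCanonical_apply (hℓ : IsStrongConnection δ ℓ) (h : H) :
    δ.preCanonical (ℓ h) = 1 ⊗ₜ[k] h := by
  rw [preCanonical_eq, hℓ.right, LinearEquiv.symm_apply_apply]
  have : ∀ x : H ⊗[k] H, TensorProduct.map (LinearMap.mul' k A) LinearMap.id
      (TensorProduct.map ℓ LinearMap.id x) =
      TensorProduct.map (Algebra.linearMap k A) (LinearMap.id : H →ₗ[k] H)
        (LinearMap.rTensor H Coalgebra.counit x) := by
    intro x
    induction x with
    | zero => simp
    | add x y hx hy => simp only [map_add, hx, hy]
    | tmul g h => simp [hℓ.mul]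
  rw [this, Coalgebra.rTensor_counit_comul]
  simp

theorem preCanonical_connectionLift (hℓ : IsStrongConnection δ ℓ) (x : A ⊗[k] H) :
    δ.preCanonical (connectionLift ℓ x) = x := by
  induction x with
  | zero => simp
  | add x y hx hy => simp only [map_add, hx, hy]
  | tmul a h =>
    rw [connectionLift_tmul, preCanonical_mul, hℓ.preCanonical_apply]
    simp

theorem mul_connectionLift (hℓ : IsStrongConnection δ ℓ) (x : A ⊗[k] H) :
    LinearMap.mul' k A (connectionLift ℓ x) =
      TensorProduct.rid k A (TensorProduct.map LinearMap.id Coalgebra.counit x) := by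
  induction x with
  | zero => simp
  | add x y hx hy => simp only [map_add, hx, hy]
  | tmul a h =>
    rw [connectionLift_tmul]
    have : ∀ y : A ⊗[k] A, LinearMap.mul' k A ((a ⊗ₜ[k] (1 : A)) * y) =
        a * LinearMap.mul' k A y := by
      intro y
      induction y with
      | zero => simp
      | add x y hx hy => simp only [mul_add, map_add, hx, hy]
      | tmul c d => simp [mul_assoc]
    rw [this, hℓ.mul]
    simp [Algebra.smul_def, (Algebra.commutes _ _)]

theorem right_connectionLift (hℓ : IsStrongConnection δ ℓ) (x : A ⊗[k] H) :
    TensorProduct.map LinearMap.id δ.toAlgHom.toLinearMap (connectionLift ℓ x) =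
      TensorProduct.assoc k A A H (TensorProduct.map (connectionLift ℓ) LinearMap.id
        ((TensorProduct.assoc k A H H).symm
          (TensorProduct.map LinearMap.id Coalgebra.comul x))) := by
  induction x with
  | zero => simp
  | add x y hx hy => simp only [map_add, hx, hy]
  | tmul a h =>
    have h1 : ∀ y : A ⊗[k] A, TensorProduct.map LinearMap.id δ.toAlgHom.toLinearMap
        ((a ⊗ₜ[k] (1 : A)) * y) = (a ⊗ₜ[k] (1 : A ⊗[k] H)) *
          TensorProduct.map LinearMap.id δ.toAlgHom.toLinearMap y := by
      intro y
      induction y with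
      | zero => simp
      | add x y hx hy => simp only [mul_add, map_add, hx, hy]
      | tmul c d => simp
    rw [connectionLift_tmul, h1, hℓ.right, TensorProduct.map_tmul, LinearMap.id_apply]
    generalize Coalgebra.comul (R := k) h = u
    induction u with
    | zero => simp
    | add x y hx hy => simp only [TensorProduct.tmul_add, mul_add, map_add, hx, hy]
    | tmul g h =>
      simp only [TensorProduct.map_tmul, TensorProduct.assoc_symm_tmul, LinearMap.id_apply,
        connectionLift_tmul]
      generalize ℓ g = v
      induction v with
      | zero => simp
      | add x y hx hy => simp only [TensorProduct.add_tmul, mul_add, map_add, hx, hy]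
      | tmul c d => simp

/-- Left colinearity turns the left side into an expression whose `H`-leg is `h₍₁₎ S(h₍₂₎)`, next to
`ℓ(h₍₃₎)`; the antipode axiom collapses that leg. -/
theorem left_aux (hℓ : IsStrongConnection δ ℓ) (h : H) :
    LinearMap.mul' k ((A ⊗[k] H) ⊗[k] A) (TensorProduct.map
      ((Algebra.TensorProduct.includeLeft : A ⊗[k] H →ₐ[k] (A ⊗[k] H) ⊗[k] A).comp
        (Algebra.TensorProduct.includeRight : H →ₐ[k] A ⊗[k] H)).toLinearMap
      (TensorProduct.map δ.toAlgHom.toLinearMap LinearMap.id ∘ₗ ℓ) (Coalgebra.comul h)) =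
    TensorProduct.map (Algebra.TensorProduct.includeLeft : A →ₐ[k] A ⊗[k] H).toLinearMap
      LinearMap.id (ℓ h) := by
  set inc := ((Algebra.TensorProduct.includeLeft : A ⊗[k] H →ₐ[k] (A ⊗[k] H) ⊗[k] A).comp
        (Algebra.TensorProduct.includeRight : H →ₐ[k] A ⊗[k] H)) with hinc
  set inl := TensorProduct.map (Algebra.TensorProduct.includeLeft : A →ₐ[k] A ⊗[k] H).toLinearMap
      (LinearMap.id : A →ₗ[k] A) with hinl
  have hleft : TensorProduct.map δ.toAlgHom.toLinearMap LinearMap.id ∘ₗ ℓ =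
      LinearMap.mul' k ((A ⊗[k] H) ⊗[k] A) ∘ₗ TensorProduct.map inc.toLinearMap inl ∘ₗ
        TensorProduct.map (HopfAlgebra.antipode k) ℓ ∘ₗ Coalgebra.comul := by
    ext g
    simp only [LinearMap.comp_apply, hℓ.left]
    generalize Coalgebra.comul (R := k) g = u
    induction u with
    | zero => simp
    | add x y hx hy => simp only [map_add, hx, hy]
    | tmul g h =>
      simp only [TensorProduct.map_tmul]
      generalize ℓ h = v
      induction v with
      | zero => simp
      | add x y hx hy => simp only [TensorProduct.tmul_add, map_add, hx, hy]
      | tmul c d => simp [inc, inl]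
  -- Reassociation brings the two factors in the `H`-leg together before the antipode axiom is
  -- applied; `inc` is multiplicative.
  have hA : ∀ x : H ⊗[k] (H ⊗[k] H), LinearMap.mul' k ((A ⊗[k] H) ⊗[k] A)
      (TensorProduct.map inc.toLinearMap (LinearMap.mul' k ((A ⊗[k] H) ⊗[k] A) ∘ₗ
        TensorProduct.map inc.toLinearMap inl ∘ₗ TensorProduct.map (HopfAlgebra.antipode k) ℓ) x) =
      LinearMap.mul' k ((A ⊗[k] H) ⊗[k] A) (TensorProduct.map inc.toLinearMap (inl ∘ₗ ℓ)
        (TensorProduct.map (LinearMap.mul' k H ∘ₗ LinearMap.lTensor H (HopfAlgebra.antipode k))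
          LinearMap.id ((TensorProduct.assoc k H H H).symm x))) := by
    intro x
    induction x with
    | zero => simp
    | add x y hx hy => simp only [map_add, hx, hy]
    | tmul g u =>
      induction u with
      | zero => simp
      | add x y hx hy => simp only [TensorProduct.tmul_add, map_add, hx, hy]
      | tmul g' h =>
        simp only [TensorProduct.map_tmul, TensorProduct.assoc_symm_tmul, LinearMap.comp_apply,
          LinearMap.mul'_apply, AlgHom.toLinearMap_apply, LinearMap.id_apply,
          LinearMap.lTensor_tmul, map_mul, mul_assoc]
  rw [hleft]
  have e1 : TensorProduct.map inc.toLinearMap (LinearMap.mul' k ((A ⊗[k] H) ⊗[k] A) ∘ₗ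
      TensorProduct.map inc.toLinearMap inl ∘ₗ
        TensorProduct.map (HopfAlgebra.antipode k) ℓ ∘ₗ Coalgebra.comul) (Coalgebra.comul h) =
      TensorProduct.map inc.toLinearMap (LinearMap.mul' k ((A ⊗[k] H) ⊗[k] A) ∘ₗ
        TensorProduct.map inc.toLinearMap inl ∘ₗ TensorProduct.map (HopfAlgebra.antipode k) ℓ)
        (LinearMap.lTensor H Coalgebra.comul (Coalgebra.comul h)) := by
    generalize Coalgebra.comul (R := k) h = u
    induction u with
    | zero => simp
    | add x y hx hy => simp only [map_add, hx, hy]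
    | tmul g h => simp
  rw [e1, hA, ← Coalgebra.coassoc_apply, LinearEquiv.symm_apply_apply]
  have e2 : ∀ u : H ⊗[k] H,
      TensorProduct.map (LinearMap.mul' k H ∘ₗ LinearMap.lTensor H (HopfAlgebra.antipode k))
        LinearMap.id (LinearMap.rTensor H Coalgebra.comul u) =
      TensorProduct.map (Algebra.linearMap k H) (LinearMap.id : H →ₗ[k] H)
        (LinearMap.rTensor H Coalgebra.counit u) := by
    intro u
    induction u with
    | zero => simp
    | add x y hx hy => simp only [map_add, hx, hy]
    | tmul g h =>
      simp only [LinearMap.rTensor_tmul, TensorProduct.map_tmul, LinearMap.comp_apply,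
        HopfAlgebra.mul_antipode_lTensor_comul_apply, Algebra.linearMap_apply]
  rw [e2, Coalgebra.rTensor_counit_comul]
  simp

/-- The first leg of `a₍₀₎ ℓ(a₍₁₎)` is coinvariant: applying `δ` to it gives `a₍₀₎` times the
expression of `left_aux` for `a₍₁₎`, after coassociativity. -/
theorem left_connectionLift (hℓ : IsStrongConnection δ ℓ) (a : A) :
    TensorProduct.map δ.toAlgHom.toLinearMap LinearMap.id (connectionLift ℓ (δ.toAlgHom a)) =
      TensorProduct.map (Algebra.TensorProduct.includeLeft : A →ₐ[k] A ⊗[k] H).toLinearMap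
        LinearMap.id (connectionLift ℓ (δ.toAlgHom a)) := by
  set G := TensorProduct.map δ.toAlgHom.toLinearMap (LinearMap.id : A →ₗ[k] A) ∘ₗ ℓ with hG
  have e1 : ∀ x : A ⊗[k] H, TensorProduct.map δ.toAlgHom.toLinearMap LinearMap.id
      (connectionLift ℓ x) = LinearMap.mul' k ((A ⊗[k] H) ⊗[k] A) (TensorProduct.map
        (Algebra.TensorProduct.includeLeft : A ⊗[k] H →ₐ[k] (A ⊗[k] H) ⊗[k] A).toLinearMap G
        (TensorProduct.map δ.toAlgHom.toLinearMap LinearMap.id x)) := by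
    intro x
    induction x with
    | zero => simp
    | add x y hx hy => simp only [map_add, hx, hy]
    | tmul a h =>
      rw [connectionLift_tmul, map_coaction_mul]
      simp [G]
  have e2 : ∀ x : A ⊗[k] H, LinearMap.mul' k ((A ⊗[k] H) ⊗[k] A) (TensorProduct.map
        (Algebra.TensorProduct.includeLeft : A ⊗[k] H →ₐ[k] (A ⊗[k] H) ⊗[k] A).toLinearMap G
        ((TensorProduct.assoc k A H H).symm
          (TensorProduct.map LinearMap.id Coalgebra.comul x))) =
      TensorProduct.map (Algebra.TensorProduct.includeLeft : A →ₐ[k] A ⊗[k] H).toLinearMap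
        LinearMap.id (connectionLift ℓ x) := by
    intro x
    induction x with
    | zero => simp
    | add x y hx hy => simp only [map_add, hx, hy]
    | tmul a h =>
      rw [connectionLift_tmul, map_includeLeft_mul, ← hℓ.left_aux, TensorProduct.map_tmul,
        LinearMap.id_apply]
      generalize Coalgebra.comul (R := k) h = u
      induction u with
      | zero => simp
      | add x y hx hy => simp only [TensorProduct.tmul_add, mul_add, map_add, hx, hy]
      | tmul g h => simp [G, ← mul_assoc]
  rw [e1, ← e2, ← δ.coassoc, LinearEquiv.symm_apply_apply]

/-- By flatness over a field, an element of `A ⊗ A` with coinvariant first leg comes from a unique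
element of `B ⊗ A`, so `a ↦ a₍₀₎ ℓ(a₍₁₎)` factors through `B ⊗ A`. -/
theorem exists_section (hℓ : IsStrongConnection δ ℓ) :
    ∃ s : A →ₗ[k] δ.coinvariants ⊗[k] A, ∀ a,
      TensorProduct.map δ.coinvariants.val.toLinearMap LinearMap.id (s a) =
        connectionLift ℓ (δ.toAlgHom a) := by
  have hex := Module.Flat.rTensor_exact A δ.exact_coinvariants
  have hmem : ∀ a, (connectionLift ℓ ∘ₗ δ.toAlgHom.toLinearMap) a ∈ LinearMap.range
      (TensorProduct.map δ.coinvariants.val.toLinearMap (LinearMap.id : A →ₗ[k] A)) := by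
    intro a
    refine (hex _).1 ?_
    rw [LinearMap.rTensor_sub, LinearMap.sub_apply, sub_eq_zero]
    exact hℓ.left_connectionLift a
  refine ⟨(LinearEquiv.ofInjective _ (δ.map_val_injective A)).symm.toLinearMap ∘ₗ
    (connectionLift ℓ ∘ₗ δ.toAlgHom.toLinearMap).codRestrict _ hmem, fun a => ?_⟩
  exact congrArg Subtype.val ((LinearEquiv.ofInjective _ (δ.map_val_injective A)).apply_symm_apply
    ⟨_, hmem a⟩)

theorem isEquivariantlyProjective (hℓ : IsStrongConnection δ ℓ) :
    δ.IsEquivariantlyProjective := by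
  obtain ⟨s, hs⟩ := hℓ.exists_section
  refine ⟨s, fun b a => ?_, fun a => ?_, fun a => ?_⟩
  -- Equations in `B ⊗ A` are tested in `A ⊗ A`, where the section is the explicit map `a ↦ a₍₀₎
  -- ℓ(a₍₁₎)`.
  · apply δ.map_val_injective A
    have hb : ∀ y : δ.coinvariants ⊗[k] A,
        TensorProduct.map δ.coinvariants.val.toLinearMap LinearMap.id (b • y) =
        ((b : A) ⊗ₜ[k] (1 : A)) *
          TensorProduct.map δ.coinvariants.val.toLinearMap LinearMap.id y := by
      intro y
      induction y with
      | zero => simp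
      | add x y hx hy => simp only [smul_add, mul_add, map_add, hx, hy]
      | tmul c d => simp [TensorProduct.smul_tmul']
    rw [hb, hs, hs, map_mul, (δ.mem_coinvariants b).1 b.2, connectionLift_mul]
  · apply δ.map_val_injective (A ⊗[k] H)
    have e1 : ∀ x : A ⊗[k] H, TensorProduct.map δ.coinvariants.val.toLinearMap LinearMap.id
        (TensorProduct.assoc k δ.coinvariants A H (TensorProduct.map s LinearMap.id x)) =
        TensorProduct.assoc k A A H (TensorProduct.map (connectionLift ℓ) LinearMap.id
          (TensorProduct.map δ.toAlgHom.toLinearMap LinearMap.id x)) := by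
      intro x
      induction x with
      | zero => simp
      | add x y hx hy => simp only [map_add, hx, hy]
      | tmul a h =>
        simp only [TensorProduct.map_tmul, AlgHom.toLinearMap_apply, ← hs, LinearMap.id_apply]
        generalize s a = u
        induction u with
        | zero => simp
        | add x y hx hy => simp only [TensorProduct.add_tmul, map_add, hx, hy]
        | tmul b c => simp
    have e2 : ∀ y : δ.coinvariants ⊗[k] A,
        TensorProduct.map δ.coinvariants.val.toLinearMap LinearMap.id
          (TensorProduct.map LinearMap.id δ.toAlgHom.toLinearMap y) =
        TensorProduct.map LinearMap.id δ.toAlgHom.toLinearMap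
          (TensorProduct.map δ.coinvariants.val.toLinearMap LinearMap.id y) := by
      intro y
      induction y with
      | zero => simp
      | add x y hx hy => simp only [map_add, hx, hy]
      | tmul c d => simp
    rw [e1, e2, hs, hℓ.right_connectionLift, ← δ.coassoc, LinearEquiv.symm_apply_apply]
  · rw [hs, hℓ.mul_connectionLift, δ.counit]

theorem isHopfGalois (hℓ : IsStrongConnection δ ℓ) : δ.IsHopfGalois := by
  obtain ⟨s, hs⟩ := hℓ.exists_section
  constructor
  · rw [← LinearMap.ker_eq_bot, LinearMap.ker_eq_bot']
    intro x hx
    obtain ⟨y, rfl⟩ := Submodule.mkQ_surjective _ x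
    have hy : δ.preCanonical y = 0 := hx
    -- For a tensor coming from `B ⊗ A`, the first leg may cross the balanced tensor sign. With `w =
    -- s c` this shows that `a c₍₀₎ ℓ(c₍₁₎)` and `a ⊗ c` have the same class, which is injectivity.
    have hmk : ∀ (a : A) (w : δ.coinvariants ⊗[k] A),
        (balancedRel δ.coinvariants).mkQ ((a ⊗ₜ[k] (1 : A)) *
          TensorProduct.map δ.coinvariants.val.toLinearMap LinearMap.id w) =
        (balancedRel δ.coinvariants).mkQ (a ⊗ₜ[k] LinearMap.mul' k A
          (TensorProduct.map δ.coinvariants.val.toLinearMap LinearMap.id w)) := by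
      intro a w
      induction w with
      | zero => simp
      | add x y hx hy => simp only [TensorProduct.tmul_add, mul_add, map_add, hx, hy]
      | tmul b c =>
        rw [← sub_eq_zero, ← map_sub, Submodule.mkQ_apply, Submodule.Quotient.mk_eq_zero]
        exact Submodule.subset_span ⟨a, c, b, b.2, by simp⟩
    have key : ∀ y : A ⊗[k] A, (balancedRel δ.coinvariants).mkQ
        (connectionLift ℓ (δ.preCanonical y)) = (balancedRel δ.coinvariants).mkQ y := by
      intro y
      induction y with
      | zero => simp
      | add x y hx hy => simp only [map_add, hx, hy]
      | tmul a c =>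
        rw [preCanonical_tmul, connectionLift_mul, ← hs, hmk, hs, hℓ.mul_connectionLift,
          δ.counit]
    rw [← key, hy, map_zero, map_zero]
  · intro x
    exact ⟨Submodule.Quotient.mk (connectionLift ℓ x), hℓ.preCanonical_connectionLift x⟩

end IsStrongConnection

end StrongConnection

end RightCoaction

/-! ### Harmonic polynomials and the Fischer decomposition. -/

section Harmonic

open MvPolynomial

/-- The polynomial algebra in variables `z_i` (`Sum.inl i`) and `z_i^*` (`Sum.inr i`). -/
abbrev Poly (n : ℕ) : Type := MvPolynomial (Fin n ⊕ Fin n) ℂ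

/-- The quadratic form `∑ z_i^* z_i`. -/
def normSq (n : ℕ) : Poly n := ∑ i, X (Sum.inr i) * X (Sum.inl i)

/-- The Laplace operator `∑ ∂²/∂z_i ∂z_i^*`. -/
def laplacian (n : ℕ) : Poly n →ₗ[ℂ] Poly n :=
  ∑ i, (pderiv (Sum.inl i)).toLinearMap ∘ₗ (pderiv (Sum.inr i)).toLinearMap

variable {n : ℕ}

theorem laplacian_apply (f : Poly n) :
    laplacian n f = ∑ i, pderiv (Sum.inl i) (pderiv (Sum.inr i) f) := by
  simp [laplacian]

theorem normSq_isHomogeneous : (normSq n).IsHomogeneous 2 :=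
  IsHomogeneous.sum _ _ _ fun _ _ => (isHomogeneous_X ℂ _).mul (isHomogeneous_X ℂ _)

theorem pderiv_inr_normSq (i : Fin n) : pderiv (Sum.inr i) (normSq n) = X (Sum.inl i) := by
  simp [normSq, Derivation.leibniz, pderiv_X, Pi.single_apply]

theorem pderiv_inl_normSq (i : Fin n) : pderiv (Sum.inl i) (normSq n) = X (Sum.inr i) := by
  simp [normSq, Derivation.leibniz, pderiv_X, Pi.single_apply]

theorem normSq_ne_zero (hn : n ≠ 0) : normSq n ≠ 0 := by
  intro h
  have := pderiv_inr_normSq (⟨0, Nat.pos_of_ne_zero hn⟩ : Fin n)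
  rw [h, map_zero] at this
  exact X_ne_zero _ this.symm

/-- In the Leibniz expansion the mixed first-order terms form the Euler operator, which contributes
`d`; the second derivatives of `normSq n` contribute `n`. -/
theorem laplacian_normSq_mul {f : Poly n} {d : ℕ} (hf : f.IsHomogeneous d) :
    laplacian n (normSq n * f) = normSq n * laplacian n f + ((d + n : ℕ) : ℂ) • f := by
  have hE := hf.sum_X_mul_pderiv
  rw [Fintype.sum_sum_type] at hE
  simp only [laplacian_apply, Derivation.leibniz, map_add, smul_eq_mul, pderiv_inr_normSq,
    pderiv_inl_normSq, pderiv_X_self, Finset.sum_add_distrib, Finset.mul_sum, mul_one,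
    Finset.sum_const, Finset.card_univ, Fintype.card_fin]
  push_cast
  rw [add_smul, ← Nat.cast_smul_eq_nsmul ℂ d f] at *
  rw [← hE, ← Nat.cast_smul_eq_nsmul ℂ n f]
  simp only [mul_comm (pderiv _ _) (X _)]
  ring

/-- The scalar is the sum of `d + 2j + n` over `0 ≤ j ≤ k`. It is nonzero as soon as `n ≠ 0`, which
drives both existence and uniqueness of harmonic representatives. -/
theorem laplacian_normSq_pow_mul {f : Poly n} {d : ℕ} (hf : f.IsHomogeneous d) (k : ℕ) :
    laplacian n (normSq n ^ (k + 1) * f) = normSq n ^ (k + 1) * laplacian n f +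
      (((k + 1) * (d + k + n) : ℕ) : ℂ) • (normSq n ^ k * f) := by
  induction k with
  | zero => simpa using laplacian_normSq_mul hf
  | succ k ih =>
    have h := laplacian_normSq_mul ((normSq_isHomogeneous.pow (k + 1)).mul hf)
    rw [pow_succ' _ (k + 1), mul_assoc, h, ih]
    simp only [smul_eq_C_mul]
    push_cast
    simp only [map_add, map_mul, map_natCast, map_one, map_ofNat]
    ring

theorem IsHomogeneous.laplacian_eq_zero {f : Poly n} {d : ℕ} (hf : f.IsHomogeneous d)
    (hd : d < 2) : laplacian n f = 0 := by
  rw [laplacian_apply]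
  refine Finset.sum_eq_zero fun i _ => ?_
  have h : (pderiv (Sum.inr i) f).IsHomogeneous 0 := by
    have := hf.pderiv (i := Sum.inr i)
    rwa [show d - 1 = 0 by omega] at this
  rw [totalDegree_eq_zero_iff_eq_C.1 (Nat.le_zero.1 h.totalDegree_le), pderiv_C]

theorem IsHomogeneous.laplacian {f : Poly n} {d : ℕ} (hf : f.IsHomogeneous d) :
    (laplacian n f).IsHomogeneous (d - 2) := by
  rw [laplacian_apply]
  exact IsHomogeneous.sum _ _ _ fun i _ => hf.pderiv.pderiv

/-- The span of the polynomials `normSq ^ k * h` of degree `d`, with `h` harmonic and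
homogeneous. -/
def harmonicTower (n d : ℕ) : Submodule ℂ (Poly n) :=
  Submodule.span ℂ {f | ∃ k e h, h.IsHomogeneous e ∧ laplacian n h = 0 ∧ 2 * k + e = d ∧
    f = normSq n ^ k * h}

/-- On `normSq n ^ k * h` with `h` harmonic, multiplication by `normSq n` followed by the Laplace
operator is a nonzero scalar, so the equation is solved by dividing. -/
theorem exists_laplacian_normSq_mul (hn : n ≠ 0) {d : ℕ} {w : Poly n}
    (hw : w ∈ harmonicTower n d) :
    ∃ g, g.IsHomogeneous d ∧ normSq n * g ∈ harmonicTower n (d + 2) ∧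
      laplacian n (normSq n * g) = w := by
  induction hw using Submodule.span_induction with
  | mem w hw =>
    obtain ⟨k, e, h, he, hh, rfl, rfl⟩ := hw
    have hc : (((k + 1) * (e + k + n) : ℕ) : ℂ) ≠ 0 := by
      rw [Nat.cast_ne_zero]
      exact mul_ne_zero (by omega) (by omega)
    refine ⟨(((k + 1) * (e + k + n) : ℕ) : ℂ)⁻¹ • (normSq n ^ k * h), ?_, ?_, ?_⟩
    · exact (homogeneousSubmodule _ ℂ _).smul_mem _ ((normSq_isHomogeneous.pow k).mul he)
    · rw [mul_smul_comm]
      exact Submodule.smul_mem _ _ (Submodule.subset_span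
        ⟨k + 1, e, h, he, hh, by ring, by ring⟩)
    · rw [mul_smul_comm, ← mul_assoc, ← pow_succ', map_smul, laplacian_normSq_pow_mul he, hh,
        mul_zero, zero_add, smul_smul, inv_mul_cancel₀ hc, one_smul]
  | zero => exact ⟨0, isHomogeneous_zero _ _ _, by simp, by simp⟩
  | add x y _ _ hx hy =>
    obtain ⟨g, hg, hgm, rfl⟩ := hx
    obtain ⟨g', hg', hgm', rfl⟩ := hy
    exact ⟨g + g', hg.add hg', by rw [mul_add]; exact add_mem hgm hgm', by rw [mul_add, map_add]⟩
  | smul c x _ hx =>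
    obtain ⟨g, hg, hgm, rfl⟩ := hx
    exact ⟨c • g, (homogeneousSubmodule _ ℂ _).smul_mem _ hg,
      by rw [mul_smul_comm]; exact Submodule.smul_mem _ _ hgm, by rw [mul_smul_comm, map_smul]⟩

/-- By induction the Laplacian of `f` lies in the tower two degrees lower, so it is also the
Laplacian of some `normSq n * g` in the tower; the difference `f - normSq n * g` is harmonic. -/
theorem mem_harmonicTower (hn : n ≠ 0) (d : ℕ) :
    ∀ f : Poly n, f.IsHomogeneous d → f ∈ harmonicTower n d := by
  induction d using Nat.strong_induction_on with
  | _ d ih =>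
    intro f hf
    have harm : ∀ g : Poly n, g.IsHomogeneous d → laplacian n g = 0 → g ∈ harmonicTower n d :=
      fun g hg hg' => Submodule.subset_span ⟨0, d, g, hg, hg', by ring, by ring⟩
    by_cases hd : d < 2
    · exact harm f hf (IsHomogeneous.laplacian_eq_zero hf hd)
    · obtain ⟨e, rfl⟩ : ∃ e, d = e + 2 := ⟨d - 2, by omega⟩
      obtain ⟨g, hg, hgm, hgl⟩ := exists_laplacian_normSq_mul hn
        (ih e (by omega) _ (IsHomogeneous.laplacian hf))
      have hDg : (normSq n * g).IsHomogeneous (e + 2) := by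
        rw [add_comm]; exact normSq_isHomogeneous.mul hg
      have := harm (f - normSq n * g) ((homogeneousSubmodule _ ℂ _).sub_mem hf hDg)
        (by rw [map_sub, hgl, sub_self])
      simpa using add_mem this hgm

/-- Modulo `normSq n - 1` the powers of `normSq n` in the harmonic decomposition become `1`, leaving
a sum of harmonic polynomials. -/
theorem exists_harmonic_sub_dvd (hn : n ≠ 0) (f : Poly n) :
    ∃ h, laplacian n h = 0 ∧ normSq n - 1 ∣ f - h := by
  have hsub : ∀ w ∈ ⨆ d, harmonicTower n d, ∃ h, laplacian n h = 0 ∧ normSq n - 1 ∣ w - h := by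
    intro w hw
    rw [show (⨆ d, harmonicTower n d) = Submodule.span ℂ (⋃ d, {f | ∃ k e h, h.IsHomogeneous e ∧
      laplacian n h = 0 ∧ 2 * k + e = d ∧ f = normSq n ^ k * h}) from
        (Submodule.span_iUnion _).symm] at hw
    induction hw using Submodule.span_induction with
    | mem w hw =>
      obtain ⟨d, hd⟩ := Set.mem_iUnion.1 hw
      obtain ⟨k, e, h, -, hh, -, rfl⟩ := hd
      refine ⟨h, hh, ?_⟩
      rw [← sub_one_mul]
      have := sub_dvd_pow_sub_pow (normSq n) 1 k
      rw [one_pow] at this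
      exact this.mul_right h
    | zero => exact ⟨0, by simp, by simp⟩
    | add x y _ _ hx hy =>
      obtain ⟨h, hh, hd⟩ := hx
      obtain ⟨h', hh', hd'⟩ := hy
      exact ⟨h + h', by rw [map_add, hh, hh', add_zero], by
        rw [add_sub_add_comm]; exact dvd_add hd hd'⟩
    | smul c x _ hx =>
      obtain ⟨h, hh, hd⟩ := hx
      exact ⟨c • h, by rw [map_smul, hh, smul_zero], by
        rw [← smul_sub]; exact dvd_smul_of_dvd c hd⟩
  apply hsub
  rw [← sum_homogeneousComponent f]
  exact Submodule.sum_mem _ fun d _ => Submodule.mem_iSup_of_mem d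
    (mem_harmonicTower hn d _ (homogeneousComponent_isHomogeneous d f))

/-- Cancelling `normSq n ^ k` in the expansion gives `normSq n * laplacian n g = -(c • g)` with `c ≠
0`. Hence `laplacian n g` satisfies the hypothesis with exponent `k + 1` and lower degree, vanishes
by induction, and so does `g`. The exponent must vary in the induction for this reason. -/
theorem eq_zero_of_laplacian_normSq_pow_mul (hn : n ≠ 0) (d : ℕ) :
    ∀ (k : ℕ) (g : Poly n), g.IsHomogeneous d → laplacian n (normSq n ^ (k + 1) * g) = 0 →
      g = 0 := by
  induction d using Nat.strong_induction_on with
  | _ d ih =>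
    intro k g hg h
    have hc : (((k + 1) * (d + k + n) : ℕ) : ℂ) ≠ 0 := by
      rw [Nat.cast_ne_zero]
      exact mul_ne_zero (by omega) (by omega)
    have h2 := h
    rw [laplacian_normSq_pow_mul hg] at h2
    generalize (((k + 1) * (d + k + n) : ℕ) : ℂ) = c at hc h2
    have h3 : normSq n * laplacian n g = -(c • g) := by
      apply mul_left_cancel₀ (pow_ne_zero k (normSq_ne_zero hn))
      rw [← mul_assoc, ← pow_succ, mul_neg, mul_smul_comm]
      exact eq_neg_of_add_eq_zero_left h2
    have h4 : laplacian n g = 0 := by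
      by_cases hd : d < 2
      · exact IsHomogeneous.laplacian_eq_zero hg hd
      · refine ih (d - 2) (by omega) (k + 1) _ (IsHomogeneous.laplacian hg) ?_
        rw [pow_succ, mul_assoc, h3, mul_neg, mul_smul_comm, map_neg, map_smul, h, smul_zero,
          neg_zero]
    rw [h4, mul_zero, eq_comm, neg_eq_zero] at h3
    exact (smul_eq_zero.1 h3).resolve_left hc

theorem homogeneousComponent_laplacian (d : ℕ) (f : Poly n) :
    homogeneousComponent d (laplacian n f) = laplacian n (homogeneousComponent (d + 2) f) := by
  have h : ∀ (e : ℕ) (g : Poly n), g.IsHomogeneous e →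
      homogeneousComponent d (laplacian n g) = laplacian n (homogeneousComponent (d + 2) g) := by
    intro e g hg
    rw [homogeneousComponent_of_mem hg]
    -- The degree `e - 2` of the Laplacian is a truncated subtraction, so degrees `0` and `1`, where
    -- the Laplacian vanishes, are separated off.
    by_cases he : e < 2
    · rw [IsHomogeneous.laplacian_eq_zero hg he, if_neg (by omega), map_zero, map_zero]
    · rw [homogeneousComponent_of_mem (IsHomogeneous.laplacian hg)]
      by_cases hd : e = d + 2
      · rw [if_pos (by omega), if_pos (by omega)]
      · rw [if_neg (by omega), if_neg (by omega), map_zero]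
  rw [← sum_homogeneousComponent f]
  simp only [map_sum]
  exact Finset.sum_congr rfl fun e _ => h e _ (homogeneousComponent_isHomogeneous e f)

theorem homogeneousComponent_normSq_mul (d : ℕ) (f : Poly n) :
    homogeneousComponent (d + 2) (normSq n * f) = normSq n * homogeneousComponent d f := by
  have h : ∀ (e : ℕ) (g : Poly n), g.IsHomogeneous e →
      homogeneousComponent (d + 2) (normSq n * g) = normSq n * homogeneousComponent d g := by
    intro e g hg
    rw [homogeneousComponent_of_mem hg, homogeneousComponent_of_mem (normSq_isHomogeneous.mul hg)]
    by_cases hd : e = d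
    · rw [if_pos (by omega), if_pos (by omega)]
    · rw [if_neg (by omega), if_neg (by omega), mul_zero]
  conv_lhs => rw [← sum_homogeneousComponent f]
  conv_rhs => rw [← sum_homogeneousComponent f]
  simp only [map_sum, Finset.mul_sum]
  exact Finset.sum_congr rfl fun e _ => h e _ (homogeneousComponent_isHomogeneous e f)

/-- If `f = (normSq n - 1) * g`, the component of `f` two degrees above the top of `g` is `normSq n`
times the top component of `g`. It is harmonic, which forces that top component to vanish. -/
theorem eq_zero_of_harmonic_of_dvd (hn : n ≠ 0) {f : Poly n} (hf : laplacian n f = 0)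
    (hd : normSq n - 1 ∣ f) : f = 0 := by
  obtain ⟨g, rfl⟩ := hd
  have hg : homogeneousComponent g.totalDegree g = 0 := by
    refine eq_zero_of_laplacian_normSq_pow_mul hn g.totalDegree 0 _
      (homogeneousComponent_isHomogeneous _ g) ?_
    have h := congrArg (homogeneousComponent g.totalDegree) hf
    rw [homogeneousComponent_laplacian, sub_one_mul, map_sub, homogeneousComponent_normSq_mul,
      homogeneousComponent_eq_zero (g.totalDegree + 2) g (by omega), sub_zero, map_zero] at h
    simpa using h
  have : g = 0 := by
    by_contra hne
    -- A monomial attaining the total degree has a nonzero coefficient in the top component.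
    obtain ⟨b, hb, hbd⟩ := Finset.exists_mem_eq_sup g.support (support_nonempty.2 hne)
      (fun s => s.sum fun _ e => e)
    have hbc := congrArg (coeff b) hg
    have hdeg : b.degree = g.totalDegree := hbd.symm
    rw [coeff_homogeneousComponent, if_pos hdeg] at hbc
    exact mem_support_iff.1 hb hbc
  rw [this, mul_zero]

theorem mk_eq_zero_iff (f : Poly n) : OSphere.mk n f = 0 ↔ normSq n - 1 ∣ f := by
  rw [← Ideal.mem_span_singleton]
  exact Ideal.Quotient.eq_zero_iff_mem

/-- Every function on the sphere has a unique harmonic representative. -/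
theorem harmonic_bijective (hn : n ≠ 0) : Function.Bijective
    ((OSphere.mk n).toLinearMap ∘ₗ (LinearMap.ker (laplacian n)).subtype) := by
  constructor
  · rw [← LinearMap.ker_eq_bot, LinearMap.ker_eq_bot']
    rintro ⟨f, hf⟩ h
    exact Subtype.ext (eq_zero_of_harmonic_of_dvd hn hf ((mk_eq_zero_iff f).1 h))
  · intro x
    obtain ⟨f, rfl⟩ := Ideal.Quotient.mkₐ_surjective ℂ _ x
    obtain ⟨h, hh, hd⟩ := exists_harmonic_sub_dvd hn f
    refine ⟨⟨h, hh⟩, ?_⟩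
    have := (mk_eq_zero_iff _).2 hd
    rw [map_sub, sub_eq_zero] at this
    exact this.symm

/-- The linear map sending a function on the sphere to the harmonic polynomial which restricts
to it. -/
def harmonicLift (hn : n ≠ 0) : OSphere n →ₗ[ℂ] Poly n :=
  (LinearMap.ker (laplacian n)).subtype ∘ₗ
    (LinearEquiv.ofBijective _ (harmonic_bijective hn)).symm.toLinearMap

theorem laplacian_harmonicLift (hn : n ≠ 0) (x : OSphere n) :
    laplacian n (harmonicLift hn x) = 0 :=
  ((LinearEquiv.ofBijective _ (harmonic_bijective hn)).symm x).2

theorem mk_harmonicLift (hn : n ≠ 0) (x : OSphere n) : OSphere.mk n (harmonicLift hn x) = x :=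
  (LinearEquiv.ofBijective _ (harmonic_bijective hn)).apply_symm_apply x

theorem harmonicLift_mk (hn : n ≠ 0) {f : Poly n} (hf : laplacian n f = 0) :
    harmonicLift hn (OSphere.mk n f) = f :=
  congrArg Subtype.val ((LinearEquiv.ofBijective _ (harmonic_bijective hn)).symm_apply_apply
    ⟨f, hf⟩)

/-- A map of polynomials which commutes with the Laplace operator and descends to the sphere
commutes with the harmonic lift. -/
theorem harmonicLift_equivariant (hn : n ≠ 0) {M : Type*} [AddCommGroup M] [Module ℂ M]
    (φ : Poly n →ₗ[ℂ] Poly n ⊗[ℂ] M) (ψ : OSphere n →ₗ[ℂ] OSphere n ⊗[ℂ] M)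
    (hmk : ∀ f, LinearMap.rTensor M (OSphere.mk n).toLinearMap (φ f) = ψ (OSphere.mk n f))
    (hlap : ∀ f, LinearMap.rTensor M (laplacian n) (φ f) = φ (laplacian n f)) (x : OSphere n) :
    φ (harmonicLift hn x) = LinearMap.rTensor M (harmonicLift hn) (ψ x) := by
  -- Flatness identifies the kernel of the Laplacian tensored with `M` with harmonic polynomials
  -- tensored with `M`. There the restriction to the sphere is inverted by the harmonic lift, so it
  -- suffices to compare after restriction.
  have hex := Module.Flat.rTensor_exact M (LinearMap.exact_subtype_ker_map (laplacian n))
  obtain ⟨y, hy⟩ := (hex (φ (harmonicLift hn x))).1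
    (by rw [hlap, laplacian_harmonicLift, map_zero])
  have h : ∀ y : LinearMap.ker (laplacian n) ⊗[ℂ] M, LinearMap.rTensor M (harmonicLift hn)
      (LinearMap.rTensor M (OSphere.mk n).toLinearMap
        (LinearMap.rTensor M (LinearMap.ker (laplacian n)).subtype y)) =
      LinearMap.rTensor M (LinearMap.ker (laplacian n)).subtype y := by
    intro y
    induction y with
    | zero => simp
    | add x y hx hy => simp only [map_add, hx, hy]
    | tmul f m => simp [harmonicLift_mk hn f.2]
  have h' := h y
  rw [hy, hmk, mk_harmonicLift] at h'
  exact h'.symm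

end Harmonic

/-! ### Derivations of polynomial algebras: chain rule and commutation. -/

section Derivations

variable {k R H : Type*} [CommRing k] [CommRing R] [Algebra k R] [CommRing H] [Algebra k H]

/-- The derivation `D ⊗ id` of `R ⊗ H`. -/
def derivationTensor (H : Type*) [CommRing H] [Algebra k H] (D : Derivation k R R) :
    Derivation k (R ⊗[k] H) (R ⊗[k] H) :=
  Derivation.mk' (LinearMap.rTensor H D.toLinearMap) (by
    intro x y
    induction x with
    | zero => simp
    | add x x' hx hx' => simp only [add_mul, map_add, hx, hx', add_smul, smul_add]; abel
    | tmul a g =>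
      induction y with
      | zero => simp
      | add y y' hy hy' => simp only [mul_add, map_add, hy, hy', add_smul, smul_add]; abel
      | tmul c h =>
        simp [TensorProduct.add_tmul, mul_comm g h])

@[simp] theorem derivationTensor_tmul (D : Derivation k R R) (a : R) (h : H) :
    derivationTensor H D (a ⊗ₜ[k] h) = D a ⊗ₜ[k] h := rfl

/-- The chain rule, used for the linear substitutions `polyRight` and `polyLeft` with coefficients
in `O(SU(2))`. -/
theorem derivation_algHom_mvPolynomial {σ : Type*} [Fintype σ]
    (φ : MvPolynomial σ k →ₐ[k] R) (D : Derivation k R R) (f : MvPolynomial σ k) :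
    D (φ f) = ∑ i, φ (MvPolynomial.pderiv i f) * D (φ (MvPolynomial.X i)) := by
  classical
  induction f using MvPolynomial.induction_on with
  | C a =>
    simp [← MvPolynomial.algebraMap_eq]
  | add p q hp hq => simp only [map_add, hp, hq, add_mul, Finset.sum_add_distrib]
  | mul_X p i hp =>
    simp only [map_mul, Derivation.leibniz, hp, map_add, smul_eq_mul, add_mul,
      Finset.sum_add_distrib, MvPolynomial.pderiv_X, Pi.single_apply, Finset.mul_sum]
    simp only [apply_ite φ, map_one, map_zero, mul_ite, ite_mul, mul_one, mul_zero, zero_mul,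
      Finset.sum_ite_eq, Finset.mem_univ, if_true, mul_assoc]

/-- The commutator of two derivations is a derivation, and this one kills the variables. -/
theorem pderiv_comm {σ : Type*} (i j : σ) (f : MvPolynomial σ k) :
    MvPolynomial.pderiv i (MvPolynomial.pderiv j f) =
      MvPolynomial.pderiv j (MvPolynomial.pderiv i f) := by
  classical
  have h : ⁅(MvPolynomial.pderiv i : Derivation k (MvPolynomial σ k) (MvPolynomial σ k)),
      (MvPolynomial.pderiv j : Derivation k (MvPolynomial σ k) (MvPolynomial σ k))⁆ = 0 := by
    apply MvPolynomial.derivation_ext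
    intro l
    by_cases h1 : l = i <;> by_cases h2 : l = j <;>
      simp [Derivation.commutator_apply, MvPolynomial.pderiv_X, Pi.single_apply, h1, h2, apply_ite]
  have := DFunLike.congr_fun h f
  rwa [Derivation.commutator_apply, Derivation.zero_apply, sub_eq_zero] at this

end Derivations

/-! ### Invariance of the Laplace operator under the two regular coactions. -/

section PolyCoactions

open MvPolynomial OSphere

/-- The extension of the right regular coaction of `O(SU(2))` to polynomials in the matrix
coefficients. -/
def polyRight : Poly 2 →ₐ[ℂ] Poly 2 ⊗[ℂ] OSU2 :=
  aeval (Sum.elim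
    ![X (Sum.inl 0) ⊗ₜ z 0 - X (Sum.inr 1) ⊗ₜ z 1, X (Sum.inl 1) ⊗ₜ z 0 + X (Sum.inr 0) ⊗ₜ z 1]
    ![X (Sum.inr 0) ⊗ₜ zs 0 - X (Sum.inl 1) ⊗ₜ zs 1,
      X (Sum.inr 1) ⊗ₜ zs 0 + X (Sum.inl 0) ⊗ₜ zs 1])

/-- The extension of the left regular coaction of `O(SU(2))`, with the tensor factors
exchanged, to polynomials in the matrix coefficients. -/
def polyLeft : Poly 2 →ₐ[ℂ] Poly 2 ⊗[ℂ] OSU2 :=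
  aeval (Sum.elim
    ![X (Sum.inl 0) ⊗ₜ z 0 - X (Sum.inl 1) ⊗ₜ zs 1, X (Sum.inl 0) ⊗ₜ z 1 + X (Sum.inl 1) ⊗ₜ zs 0]
    ![X (Sum.inr 0) ⊗ₜ zs 0 - X (Sum.inr 1) ⊗ₜ z 1,
      X (Sum.inr 0) ⊗ₜ zs 1 + X (Sum.inr 1) ⊗ₜ z 0])

theorem rTensor_laplacian (x : Poly 2 ⊗[ℂ] OSU2) :
    LinearMap.rTensor OSU2 (laplacian 2) x =
      derivationTensor OSU2 (pderiv (Sum.inl 0)) (derivationTensor OSU2 (pderiv (Sum.inr 0)) x) +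
      derivationTensor OSU2 (pderiv (Sum.inl 1)) (derivationTensor OSU2 (pderiv (Sum.inr 1)) x) := by
  induction x with
  | zero => simp
  | add x y hx hy => rw [map_add, hx, hy]; simp only [map_add]; abel
  | tmul f h => simp [laplacian_apply, Fin.sum_univ_two, TensorProduct.add_tmul]

theorem one_tmul_rel : ((1 : Poly 2) ⊗ₜ[ℂ] (zs 0 : OSU2)) * (1 ⊗ₜ z 0) +
    (1 ⊗ₜ zs 1) * (1 ⊗ₜ z 1) = 1 := by
  simp only [Algebra.TensorProduct.tmul_mul_tmul, one_mul]
  rw [← TensorProduct.tmul_add, OSU2.rel, Algebra.TensorProduct.one_def]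

/-- The coaction is a linear change of variables by a matrix of determinant one. By the chain rule
the mixed terms cancel, and the remaining second derivatives acquire the factor `w_1^* w_1 + w_2^*
w_2 = 1`. -/
theorem polyRight_laplacian (f : Poly 2) :
    LinearMap.rTensor OSU2 (laplacian 2) (polyRight f) = polyRight (laplacian 2 f) := by
  have chain := derivation_algHom_mvPolynomial polyRight
  have h00 : ∀ g, derivationTensor OSU2 (pderiv (Sum.inl 0)) (polyRight g) =
      polyRight (pderiv (Sum.inl 0) g) * (1 ⊗ₜ z 0) +
        polyRight (pderiv (Sum.inr 1) g) * (1 ⊗ₜ zs 1) := by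
    intro g
    rw [chain]; simp [Fin.sum_univ_two, polyRight, pderiv_X]
  have h01 : ∀ g, derivationTensor OSU2 (pderiv (Sum.inl 1)) (polyRight g) =
      polyRight (pderiv (Sum.inl 1) g) * (1 ⊗ₜ z 0) -
        polyRight (pderiv (Sum.inr 0) g) * (1 ⊗ₜ zs 1) := by
    intro g
    rw [chain]; simp [Fin.sum_univ_two, polyRight, pderiv_X]; ring
  have h10 : ∀ g, derivationTensor OSU2 (pderiv (Sum.inr 0)) (polyRight g) =
      polyRight (pderiv (Sum.inl 1) g) * (1 ⊗ₜ z 1) +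
        polyRight (pderiv (Sum.inr 0) g) * (1 ⊗ₜ zs 0) := by
    intro g
    rw [chain]; simp [Fin.sum_univ_two, polyRight, pderiv_X]
  have h11 : ∀ g, derivationTensor OSU2 (pderiv (Sum.inr 1)) (polyRight g) =
      - polyRight (pderiv (Sum.inl 0) g) * (1 ⊗ₜ z 1) +
        polyRight (pderiv (Sum.inr 1) g) * (1 ⊗ₜ zs 0) := by
    intro g
    rw [chain]; simp [Fin.sum_univ_two, polyRight, pderiv_X]; ring
  rw [rTensor_laplacian, h10, h11, laplacian_apply, Fin.sum_univ_two]
  simp only [map_add, map_neg, Derivation.leibniz, h00, h01, derivationTensor_tmul,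
    Derivation.map_one_eq_zero, TensorProduct.zero_tmul, smul_eq_mul, mul_zero, zero_add]
  -- The right coaction mixes `z` with `z^*`, so the same mixed derivatives appear in both orders
  -- and must be matched before they cancel. For the left coaction no reordering is needed.
  rw [pderiv_comm (Sum.inl 1) (Sum.inl 0), pderiv_comm (Sum.inr 1) (Sum.inr 0),
    pderiv_comm (Sum.inr 1) (Sum.inl 1), pderiv_comm (Sum.inr 0) (Sum.inl 0)]
  linear_combination (polyRight (pderiv (Sum.inl 0) (pderiv (Sum.inr 0) f)) +
    polyRight (pderiv (Sum.inl 1) (pderiv (Sum.inr 1) f))) * one_tmul_rel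

theorem polyLeft_laplacian (f : Poly 2) :
    LinearMap.rTensor OSU2 (laplacian 2) (polyLeft f) = polyLeft (laplacian 2 f) := by
  have chain := derivation_algHom_mvPolynomial polyLeft
  have h00 : ∀ g, derivationTensor OSU2 (pderiv (Sum.inl 0)) (polyLeft g) =
      polyLeft (pderiv (Sum.inl 0) g) * (1 ⊗ₜ z 0) +
        polyLeft (pderiv (Sum.inl 1) g) * (1 ⊗ₜ z 1) := by
    intro g
    rw [chain]; simp [Fin.sum_univ_two, polyLeft, pderiv_X]
  have h01 : ∀ g, derivationTensor OSU2 (pderiv (Sum.inl 1)) (polyLeft g) =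
      - polyLeft (pderiv (Sum.inl 0) g) * (1 ⊗ₜ zs 1) +
        polyLeft (pderiv (Sum.inl 1) g) * (1 ⊗ₜ zs 0) := by
    intro g
    rw [chain]; simp [Fin.sum_univ_two, polyLeft, pderiv_X]; ring
  have h10 : ∀ g, derivationTensor OSU2 (pderiv (Sum.inr 0)) (polyLeft g) =
      polyLeft (pderiv (Sum.inr 0) g) * (1 ⊗ₜ zs 0) +
        polyLeft (pderiv (Sum.inr 1) g) * (1 ⊗ₜ zs 1) := by
    intro g
    rw [chain]; simp [Fin.sum_univ_two, polyLeft, pderiv_X]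
  have h11 : ∀ g, derivationTensor OSU2 (pderiv (Sum.inr 1)) (polyLeft g) =
      - polyLeft (pderiv (Sum.inr 0) g) * (1 ⊗ₜ z 1) +
        polyLeft (pderiv (Sum.inr 1) g) * (1 ⊗ₜ z 0) := by
    intro g
    rw [chain]; simp [Fin.sum_univ_two, polyLeft, pderiv_X]; ring
  rw [rTensor_laplacian, h10, h11, laplacian_apply, Fin.sum_univ_two]
  simp only [map_add, map_neg, Derivation.leibniz, h00, h01, derivationTensor_tmul,
    Derivation.map_one_eq_zero, TensorProduct.zero_tmul, smul_eq_mul, mul_zero, zero_add]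
  linear_combination (polyLeft (pderiv (Sum.inl 0) (pderiv (Sum.inr 0) f)) +
    polyLeft (pderiv (Sum.inl 1) (pderiv (Sum.inr 1) f))) * one_tmul_rel

theorem mk_polyRight (f : Poly 2) :
    LinearMap.rTensor OSU2 (OSphere.mk 2).toLinearMap (polyRight f) =
      Coalgebra.comul (OSphere.mk 2 f) := by
  have h : (Algebra.TensorProduct.map (OSphere.mk 2) (.id ℂ OSU2)).comp polyRight =
      OSU2.comulHom.comp (OSphere.mk 2) := by
    apply MvPolynomial.algHom_ext
    have hz (i) : mk 2 (X (Sum.inl i)) = z i := rfl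
    have hzs (i) : mk 2 (X (Sum.inr i)) = zs i := rfl
    rintro (i | i) <;> fin_cases i <;> simp [polyRight, OSU2.comulHom, hz, hzs]
  exact DFunLike.congr_fun h f

theorem mk_polyLeft (f : Poly 2) :
    LinearMap.rTensor OSU2 (OSphere.mk 2).toLinearMap (polyLeft f) =
      TensorProduct.comm ℂ OSU2 OSU2 (Coalgebra.comul (OSphere.mk 2 f)) := by
  have h : (Algebra.TensorProduct.map (OSphere.mk 2) (.id ℂ OSU2)).comp polyLeft =
      (Algebra.TensorProduct.comm ℂ OSU2 OSU2).toAlgHom.comp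
        (OSU2.comulHom.comp (OSphere.mk 2)) := by
    apply MvPolynomial.algHom_ext
    have hz (i) : mk 2 (X (Sum.inl i)) = z i := rfl
    have hzs (i) : mk 2 (X (Sum.inr i)) = zs i := rfl
    rintro (i | i) <;> fin_cases i <;> simp [polyLeft, OSU2.comulHom, hz, hzs]
  exact DFunLike.congr_fun h f

/-- The harmonic lift from `O(SU(2))` to polynomials in the matrix coefficients. -/
abbrev lift₂ : OSU2 →ₗ[ℂ] Poly 2 := harmonicLift two_ne_zero

/-- Together with `polyLeft_lift`, this is the two-sided colinearity through which the connection
inherits its colinearity from `pairing`. -/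
theorem polyRight_lift (x : OSU2) :
    polyRight (lift₂ x) = LinearMap.rTensor OSU2 lift₂ (Coalgebra.comul x) :=
  harmonicLift_equivariant two_ne_zero polyRight.toLinearMap Coalgebra.comul mk_polyRight
    polyRight_laplacian x

theorem polyLeft_lift (x : OSU2) :
    polyLeft (lift₂ x) = LinearMap.rTensor OSU2 lift₂
      (TensorProduct.comm ℂ OSU2 OSU2 (Coalgebra.comul x)) :=
  harmonicLift_equivariant two_ne_zero polyLeft.toLinearMap
    ((TensorProduct.comm ℂ OSU2 OSU2).toLinearMap ∘ₗ Coalgebra.comul) mk_polyLeft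
    polyLeft_laplacian x

end PolyCoactions

/-! ### Strong connections under cocycle twists. -/

section TwistConnection

variable {k K H A : Type*} [Field k] [Ring K] [HopfAlgebra k K] [Ring H] [HopfAlgebra k H]
  [Ring A] [Algebra k A]

set_option synthInstance.maxHeartbeats 200000 in
/-- A strong connection stays one after twisting, if the twisted multiplication agrees with the
original one on its image. -/
theorem RightCoaction.IsStrongConnection.twist {σ : TwoCocycle k K} {ρ : LeftCoaction k K A}
    {δ : RightCoaction k H A} (hρδ : IsBicomodule ρ δ) {ℓ : H →ₗ[k] A ⊗[k] A}
    (hℓ : δ.IsStrongConnection ℓ) (hσ : ∀ h, ρ.tmul σ (ℓ h) = LinearMap.mul' k A (ℓ h)) :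
    (δ.twist σ ρ hρδ).IsStrongConnection
      (TensorProduct.map (Twisted.of σ ρ).toLinearMap (Twisted.of σ ρ).toLinearMap ∘ₗ ℓ) where
  mul h := by
    have e : ∀ x : A ⊗[k] A, LinearMap.mul' k (Twisted σ ρ)
        (TensorProduct.map (Twisted.of σ ρ).toLinearMap (Twisted.of σ ρ).toLinearMap x) =
        Twisted.of σ ρ (ρ.tmul σ x) := by
      intro x
      induction x with
      | zero => simp
      | add x y hx hy => simp only [map_add, hx, hy]
      | tmul a c => simp [Twisted.of_mul_of]
    -- The normalization is the only axiom that sees the product of `A`; the hypothesis on `ℓ`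
    -- replaces the twisted product by the original one. The two colinearity axioms are transported
    -- along the linear identity.
    rw [LinearMap.comp_apply, e, hσ, hℓ.mul, Algebra.algebraMap_eq_smul_one,
      Algebra.algebraMap_eq_smul_one, map_smul, Twisted.one_def]
  right h := by
    have e1 : ∀ x : A ⊗[k] A,
        TensorProduct.map LinearMap.id (δ.twist σ ρ hρδ).toAlgHom.toLinearMap
          (TensorProduct.map (Twisted.of σ ρ).toLinearMap (Twisted.of σ ρ).toLinearMap x) =
        TensorProduct.map (Twisted.of σ ρ).toLinearMap
          (TensorProduct.map (Twisted.of σ ρ).toLinearMap LinearMap.id)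
          (TensorProduct.map LinearMap.id δ.toAlgHom.toLinearMap x) := by
      intro x
      induction x with
      | zero => simp
      | add x y hx hy => simp only [map_add, hx, hy]
      | tmul a c => simp [RightCoaction.twist_of]
    have e2 : ∀ u : H ⊗[k] H, TensorProduct.map (Twisted.of σ ρ).toLinearMap
          (TensorProduct.map (Twisted.of σ ρ).toLinearMap LinearMap.id)
          (TensorProduct.assoc k A A H (TensorProduct.map ℓ LinearMap.id u)) =
        TensorProduct.assoc k (Twisted σ ρ) (Twisted σ ρ) H (TensorProduct.map
          (TensorProduct.map (Twisted.of σ ρ).toLinearMap (Twisted.of σ ρ).toLinearMap ∘ₗ ℓ)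
          LinearMap.id u) := by
      intro u
      induction u with
      | zero => simp
      | add x y hx hy => simp only [map_add, hx, hy]
      | tmul g h =>
        simp only [TensorProduct.map_tmul, LinearMap.comp_apply]
        generalize ℓ g = v
        induction v with
        | zero => simp
        | add x y hx hy => simp only [TensorProduct.add_tmul, map_add, hx, hy]
        | tmul a c => simp
    rw [LinearMap.comp_apply, e1, hℓ.right, e2]
  left h := by
    have e1 : ∀ x : A ⊗[k] A,
        TensorProduct.map (δ.twist σ ρ hρδ).toAlgHom.toLinearMap LinearMap.id
          (TensorProduct.map (Twisted.of σ ρ).toLinearMap (Twisted.of σ ρ).toLinearMap x) =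
        TensorProduct.map (TensorProduct.map (Twisted.of σ ρ).toLinearMap LinearMap.id)
          (Twisted.of σ ρ).toLinearMap
          (TensorProduct.map δ.toAlgHom.toLinearMap LinearMap.id x) := by
      intro x
      induction x with
      | zero => simp
      | add x y hx hy => simp only [map_add, hx, hy]
      | tmul a c => simp [RightCoaction.twist_of]
    have e2 : ∀ u : H ⊗[k] H,
        TensorProduct.map (TensorProduct.map (Twisted.of σ ρ).toLinearMap LinearMap.id)
          (Twisted.of σ ρ).toLinearMap
          (TensorProduct.map (TensorProduct.comm k H A).toLinearMap LinearMap.id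
            ((TensorProduct.assoc k H A A).symm
              (TensorProduct.map (HopfAlgebra.antipode k) ℓ u))) =
        TensorProduct.map (TensorProduct.comm k H (Twisted σ ρ)).toLinearMap LinearMap.id
          ((TensorProduct.assoc k H (Twisted σ ρ) (Twisted σ ρ)).symm
            (TensorProduct.map (HopfAlgebra.antipode k)
              (TensorProduct.map (Twisted.of σ ρ).toLinearMap (Twisted.of σ ρ).toLinearMap ∘ₗ ℓ)
              u)) := by
      intro u
      induction u with
      | zero => simp
      | add x y hx hy => simp only [map_add, hx, hy]
      | tmul g h =>
        simp only [TensorProduct.map_tmul, LinearMap.comp_apply]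
        generalize ℓ h = v
        induction v with
        | zero => simp
        | add x y hx hy => simp only [TensorProduct.tmul_add, map_add, hx, hy]
        | tmul a c => simp
    rw [LinearMap.comp_apply, e1, hℓ.left, e2]

end TwistConnection

/-! ### The strong connection on the seven-sphere. -/

section StrongConnection

open OSphere MvPolynomial

theorem OS7.rel : (zs 0 : OS7) * z 0 + zs 1 * z 1 + zs 2 * z 2 + zs 3 * z 3 = 1 := by
  simpa [Fin.sum_univ_four] using sphere_relation (n := 4)

/-- The map of algebras sending the coefficient matrix to `u^* ⊗ u`. -/
def pairing : Poly 2 →ₐ[ℂ] OS7 ⊗[ℂ] OS7 :=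
  aeval (Sum.elim
    ![zs 0 ⊗ₜ z 0 + zs 1 ⊗ₜ z 1 + zs 2 ⊗ₜ z 2 + zs 3 ⊗ₜ z 3,
      z 0 ⊗ₜ z 1 - z 1 ⊗ₜ z 0 + z 2 ⊗ₜ z 3 - z 3 ⊗ₜ z 2]
    ![z 0 ⊗ₜ zs 0 + z 1 ⊗ₜ zs 1 + z 2 ⊗ₜ zs 2 + z 3 ⊗ₜ zs 3,
      zs 0 ⊗ₜ zs 1 - zs 1 ⊗ₜ zs 0 + zs 2 ⊗ₜ zs 3 - zs 3 ⊗ₜ zs 2])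

/-- Since `O(S^7)` is commutative, multiplication is an algebra map, and on generators the claim is
`u^* u = 1`: the sphere relation on the diagonal, cancelling pairs off it. -/
theorem mul_pairing (f : Poly 2) : LinearMap.mul' ℂ OS7 (pairing f) =
    algebraMap ℂ OS7 (Coalgebra.counit (R := ℂ) (OSphere.mk 2 f)) := by
  have h : (Algebra.TensorProduct.lmul' ℂ (S := OS7)).comp pairing =
      (Algebra.ofId ℂ OS7).comp (OSU2.counitHom.comp (OSphere.mk 2)) := by
    apply MvPolynomial.algHom_ext
    have hz (i) : mk 2 (X (Sum.inl i)) = z i := rfl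
    have hzs (i) : mk 2 (X (Sum.inr i)) = zs i := rfl
    have h7 := OS7.rel
    rintro (i | i) <;> fin_cases i <;> simp [pairing, OSU2.counitHom, hz, hzs] <;>
      first | ring1 | linear_combination h7
  exact DFunLike.congr_fun h f

theorem right_pairing (f : Poly 2) :
    TensorProduct.map LinearMap.id deltaHom.toLinearMap (pairing f) =
      TensorProduct.assoc ℂ OS7 OS7 OSU2
        (TensorProduct.map pairing.toLinearMap LinearMap.id (polyRight f)) := by
  have h : (Algebra.TensorProduct.map (.id ℂ OS7) deltaHom).comp pairing =
      (Algebra.TensorProduct.assoc ℂ ℂ ℂ OS7 OS7 OSU2).toAlgHom.comp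
        ((Algebra.TensorProduct.map pairing (.id ℂ OSU2)).comp polyRight) := by
    apply MvPolynomial.algHom_ext
    rintro (i | i) <;> fin_cases i <;>
      simp [pairing, polyRight, deltaHom, TensorProduct.add_tmul, TensorProduct.tmul_add,
        TensorProduct.sub_tmul, TensorProduct.tmul_sub] <;> abel
  exact DFunLike.congr_fun h f

/-- On generators this is `δ(u^*) = W^* u^*` with `W^* = S(W)`. -/
theorem left_pairing (f : Poly 2) :
    TensorProduct.map deltaHom.toLinearMap LinearMap.id (pairing f) =
      TensorProduct.rightComm ℂ OS7 OS7 OSU2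
        (TensorProduct.map pairing.toLinearMap (HopfAlgebra.antipode ℂ) (polyLeft f)) := by
  have h : (Algebra.TensorProduct.map deltaHom (.id ℂ OS7)).comp pairing =
      -- Everything is commutative, so the antipode and the right side are algebra maps; in this
      -- form the two sides can be compared on generators.
      (Algebra.TensorProduct.productMap
        ((Algebra.TensorProduct.map (Algebra.TensorProduct.includeLeft : OS7 →ₐ[ℂ] OS7 ⊗[ℂ] OSU2)
          (.id ℂ OS7)).comp pairing)
        ((Algebra.TensorProduct.includeLeft : OS7 ⊗[ℂ] OSU2 →ₐ[ℂ] (OS7 ⊗[ℂ] OSU2) ⊗[ℂ] OS7).comp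
          ((Algebra.TensorProduct.includeRight : OSU2 →ₐ[ℂ] OS7 ⊗[ℂ] OSU2).comp
            OSU2.antipodeHom))).comp polyLeft := by
    have hneg (x y : (OS7 ⊗[ℂ] OSU2) ⊗[ℂ] OS7) : x * -y = -(x * y) := mul_neg x y
    apply MvPolynomial.algHom_ext
    rintro (i | i) <;> fin_cases i <;>
      simp [pairing, polyLeft, deltaHom, OSU2.antipodeHom, TensorProduct.add_tmul,
        TensorProduct.sub_tmul, TensorProduct.tmul_neg, TensorProduct.neg_tmul, add_mul, sub_mul, hneg] <;> abel
  refine (DFunLike.congr_fun h f).trans ?_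
  rw [AlgHom.comp_apply]
  generalize polyLeft f = x
  induction x with
  | zero => simp
  | add x y hx hy => simp only [map_add, hx, hy]
  | tmul g h =>
    have hS : HopfAlgebra.antipode ℂ h = OSU2.antipodeHom h := rfl
    simp only [Algebra.TensorProduct.productMap_apply_tmul, TensorProduct.map_tmul, hS,
      AlgHom.comp_apply, AlgHom.toLinearMap_apply]
    generalize pairing g = v
    induction v with
    | zero => simp
    | add x y hx hy => simp only [TensorProduct.add_tmul, map_add, add_mul, hx, hy]
    | tmul a c => simp

/-- The strong connection on `O(S^7)`: the harmonic lift followed by `W ↦ u^* ⊗ u`. -/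
def connection : OSU2 →ₗ[ℂ] OS7 ⊗[ℂ] OS7 := pairing.toLinearMap ∘ₗ lift₂

theorem connection_isStrongConnection : delta.IsStrongConnection connection where
  mul h := by
    rw [connection, LinearMap.comp_apply, AlgHom.toLinearMap_apply, mul_pairing, mk_harmonicLift]
  right h := by
    rw [connection, LinearMap.comp_apply, AlgHom.toLinearMap_apply]
    refine (right_pairing _).trans ?_
    rw [polyRight_lift, LinearMap.rTensor, ← LinearMap.comp_apply (TensorProduct.map _ _),
      ← TensorProduct.map_comp, LinearMap.id_comp]
  left h := by
    rw [connection, LinearMap.comp_apply, AlgHom.toLinearMap_apply]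
    refine (left_pairing _).trans ?_
    rw [polyLeft_lift]
    generalize Coalgebra.comul (R := ℂ) h = u
    induction u with
    | zero => simp
    | add x y hx hy => simp only [map_add, hx, hy]
    | tmul g h =>
      simp only [TensorProduct.comm_tmul, LinearMap.rTensor_tmul, TensorProduct.map_tmul,
        LinearMap.comp_apply]
      generalize pairing.toLinearMap (lift₂ h) = v
      induction v with
      | zero => simp
      | add x y hx hy => simp only [TensorProduct.tmul_add, TensorProduct.add_tmul, map_add, hx, hy]
      | tmul a c => simp

/-- The elements `a ⊗ c` with `a` and `c` of opposite weights for the torus coaction. -/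
def balancedTensors : Submonoid (OS7 ⊗[ℂ] OS7) where
  carrier := {x | ∃ (a c : OS7) (w : Fin 2 → ℤ), rhoHom weights a = tor (-w) ⊗ₜ a ∧
    rhoHom weights c = tor w ⊗ₜ c ∧ x = a ⊗ₜ c}
  one_mem' := ⟨1, 1, 0, by simp [tor_zero, Algebra.TensorProduct.one_def],
    by simp [tor_zero, Algebra.TensorProduct.one_def], rfl⟩
  mul_mem' := by
    rintro _ _ ⟨a, c, w, ha, hc, rfl⟩ ⟨a', c', w', ha', hc', rfl⟩
    refine ⟨a * a', c * c', w + w', ?_, ?_, by simp⟩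
    · rw [map_mul, ha, ha', Algebra.TensorProduct.tmul_mul_tmul, tor_mul, neg_add]
    · rw [map_mul, hc, hc', Algebra.TensorProduct.tmul_mul_tmul, tor_mul]

theorem rhoHom_z (i : Fin 4) : rhoHom weights (z i) = tor (weights i) ⊗ₜ z i := by
  simp [rhoHom]

theorem rhoHom_zs (i : Fin 4) : rhoHom weights (zs i) = tor (-weights i) ⊗ₜ zs i := by
  simp [rhoHom]

/-- Each entry of `u^* ⊗ u` is a sum of tensors of opposite weights; for `z_1 ⊗ z_2` and its
analogues this uses `τ_2 = τ_1^*` and `τ_4 = τ_3^*`. Products of such tensors are again of this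
kind. -/
theorem pairing_mem (f : Poly 2) :
    pairing f ∈ Algebra.adjoin ℂ (balancedTensors : Set (OS7 ⊗[ℂ] OS7)) := by
  have w1 : weights 1 = -weights 0 := by ext i; fin_cases i <;> rfl
  have w3 : weights 3 = -weights 2 := by ext i; fin_cases i <;> rfl
  have hzz : ∀ i j, weights j = -weights i → (z i : OS7) ⊗ₜ[ℂ] (z j : OS7) ∈
      Algebra.adjoin ℂ (balancedTensors : Set (OS7 ⊗[ℂ] OS7)) := fun i j h =>
    Algebra.subset_adjoin ⟨_, _, weights j, by rw [rhoHom_z, h, neg_neg], rhoHom_z j, rfl⟩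
  have hss : ∀ i j, weights j = -weights i → (zs i : OS7) ⊗ₜ[ℂ] (zs j : OS7) ∈
      Algebra.adjoin ℂ (balancedTensors : Set (OS7 ⊗[ℂ] OS7)) := fun i j h =>
    Algebra.subset_adjoin ⟨_, _, -weights j, by rw [rhoHom_zs, h, neg_neg], rhoHom_zs j, rfl⟩
  have hzs : ∀ i, (z i : OS7) ⊗ₜ[ℂ] (zs i : OS7) ∈
      Algebra.adjoin ℂ (balancedTensors : Set (OS7 ⊗[ℂ] OS7)) := fun i =>
    Algebra.subset_adjoin ⟨_, _, -weights i, by rw [rhoHom_z, neg_neg], rhoHom_zs i, rfl⟩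
  have hsz : ∀ i, (zs i : OS7) ⊗ₜ[ℂ] (z i : OS7) ∈
      Algebra.adjoin ℂ (balancedTensors : Set (OS7 ⊗[ℂ] OS7)) := fun i =>
    Algebra.subset_adjoin ⟨_, _, weights i, rhoHom_zs i, rhoHom_z i, rfl⟩
  have w01 : weights 0 = -weights 1 := by rw [w1, neg_neg]
  have w23 : weights 2 = -weights 3 := by rw [w3, neg_neg]
  induction f using MvPolynomial.induction_on with
  | C a =>
    rw [← MvPolynomial.algebraMap_eq, AlgHom.commutes]
    exact Subalgebra.algebraMap_mem _ a
  | add p q hp hq => rw [map_add]; exact add_mem hp hq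
  | mul_X p i hp =>
    rw [map_mul]
    refine mul_mem hp ?_
    rcases i with i | i <;> fin_cases i
    · simpa [pairing] using add_mem (add_mem (add_mem (hsz 0) (hsz 1)) (hsz 2)) (hsz 3)
    · simpa [pairing] using
        sub_mem (add_mem (sub_mem (hzz 0 1 w1) (hzz 1 0 w01)) (hzz 2 3 w3)) (hzz 3 2 w23)
    · simpa [pairing] using add_mem (add_mem (add_mem (hzs 0) (hzs 1)) (hzs 2)) (hzs 3)
    · simpa [pairing] using
        sub_mem (add_mem (sub_mem (hss 0 1 w1) (hss 1 0 w01)) (hss 2 3 w3)) (hss 3 2 w23)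

/-- The exponent is the value of the antisymmetric form `Θ` on a vector and its negative. -/
theorem expTheta_neg_self (θ : ℝ) (w : Fin 2 → ℤ) : expTheta θ (-w) w = 1 := by
  rw [expTheta, Complex.exp_eq_one_iff]
  exact ⟨0, by simp [Theta, Fin.sum_univ_two]; ring⟩

theorem tmul_connection (θ : ℝ) (h : OSU2) :
    rho.tmul (sigma θ) (connection h) = LinearMap.mul' ℂ OS7 (connection h) := by
  have hmem := pairing_mem (lift₂ h)
  -- The balanced tensors form a submonoid, so the algebra they generate is their linear span, and a
  -- single balanced tensor can be treated.
  rw [← Subalgebra.mem_toSubmodule, Algebra.adjoin_eq_span, Submonoid.closure_eq] at hmem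
  refine LinearMap.eqOn_span (f := rho.tmul (sigma θ)) ?_ hmem
  rintro _ ⟨a, c, w, ha, hc, rfl⟩
  have ha' : rho.toAlgHom a = tor (-w) ⊗ₜ a := ha
  have hc' : rho.toAlgHom c = tor w ⊗ₜ c := hc
  have hs : (sigma θ).toLin = sigmaLin θ := rfl
  rw [tmul_eq, ha', hc', auxB_tmul, hs, sigmaLin_tor, expTheta_neg_self, one_smul,
    LinearMap.mul'_apply]

theorem antipode_bijective :
    Function.Bijective (HopfAlgebra.antipode ℂ : OSU2 →ₗ[ℂ] OSU2) := by
  have h : OSU2.antipodeHom.comp OSU2.antipodeHom = .id ℂ OSU2 := by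
    apply OSphere.algHom_ext <;> intro i <;> fin_cases i <;> simp [OSU2.antipodeHom]
  exact Function.Involutive.bijective fun x => DFunLike.congr_fun h x

theorem deltaθ_isPrincipal (θ : ℝ) : (deltaθ θ).IsPrincipal :=
  have h := connection_isStrongConnection.twist isBicomodule (tmul_connection θ)
  ⟨antipode_bijective, h.isHopfGalois, h.isEquivariantlyProjective⟩

end StrongConnection

open OSphere

/-! ### The classical Hopf map: local sections, injectivity and coinvariants. -/

namespace OS4

/-- The function `(1 + x) / 2` on the four-sphere. -/
def north : OS4 := algebraMap ℂ OS4 (1 / 2) * (1 + gen .x)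

/-- The function `(1 - x) / 2` on the four-sphere. -/
def south : OS4 := algebraMap ℂ OS4 (1 / 2) * (1 - gen .x)

theorem two_mul_half (R : Type*) [CommRing R] [Algebra ℂ R] :
    2 * algebraMap ℂ R (1 / 2) = 1 := by
  rw [← map_ofNat (algebraMap ℂ R) 2, ← map_mul]
  norm_num

theorem north_add_south : north + south = 1 := by
  rw [north, south]
  linear_combination two_mul_half OS4

theorem isCoprime_pow (N M : ℕ) : IsCoprime (north ^ N) (south ^ M) :=
  IsCoprime.pow ⟨1, 1, by rw [one_mul, one_mul, north_add_south]⟩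

section Charts

variable {R : Type*} [CommRing R] [Algebra ℂ R]

theorem map_relation (ι : OS4 →ₐ[ℂ] R) :
    ι (gen .αs) * ι (gen .α) + ι (gen .βs) * ι (gen .β) + ι (gen .x) ^ 2 = 1 := by
  rw [← map_mul, ← map_mul, ← map_pow, ← map_add, ← map_add, relation, map_one]

theorem map_north (ι : OS4 →ₐ[ℂ] R) :
    ι north = algebraMap ℂ R (1 / 2) * (1 + ι (gen .x)) := by
  rw [north, map_mul, AlgHom.commutes, map_add, map_one]

theorem map_south (ι : OS4 →ₐ[ℂ] R) :
    ι south = algebraMap ℂ R (1 / 2) * (1 - ι (gen .x)) := by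
  rw [south, map_mul, AlgHom.commutes, map_sub, map_one]

/-- The section of the Hopf map where `(1 + x) / 2` is invertible. -/
def northSection (ι : OS4 →ₐ[ℂ] R) (v : R) (hv : ι north * v = 1) : OS7 →ₐ[ℂ] R :=
  -- A `*`-compatible section would need the square root of `(1 + x) / 2`. Rescaling by an element
  -- of the complexified torus, with `z_i` and `z_i^*` independent, gives `z_1 = (1 + x) / 2` and
  -- `z_1^* = 1` and removes the root.
  OSphere.lift
    ![ι north, 0, algebraMap ℂ R (1 / 2) * ι (gen .αs), -algebraMap ℂ R (1 / 2) * ι (gen .β)]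
    ![1, 0, algebraMap ℂ R (1 / 2) * ι (gen .α) * v,
      -algebraMap ℂ R (1 / 2) * ι (gen .βs) * v] (by
    have h := map_relation ι
    have hc := two_mul_half R
    rw [map_north] at hv
    simp only [Fin.sum_univ_four, map_north, Matrix.cons_val_zero, Matrix.cons_val_one,
      Matrix.cons_val]
    generalize algebraMap ℂ R (1 / 2) = c at *
    linear_combination c ^ 2 * v * h + c * (1 - ι (gen .x)) * hv + hc)

theorem northSection_hopf (ι : OS4 →ₐ[ℂ] R) (v : R) (hv : ι north * v = 1) :
    (northSection ι v hv).comp hopf = ι := by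
  have h := map_relation ι
  have hc := two_mul_half R
  have hv' := hv
  rw [map_north] at hv'
  apply algHom_ext
  intro i
  cases i <;>
    simp only [hopf, hopfGen, northSection, map_north, AlgHom.comp_apply, lift_gen, map_add,
      map_sub, map_mul, map_ofNat, lift_z, lift_zs, Matrix.cons_val_zero, Matrix.cons_val_one,
      Matrix.cons_val] <;>
    generalize algebraMap ℂ R (1 / 2) = c at *
  · linear_combination 2 * c * ι (gen .α) * hv' + ι (gen .α) * hc
  · linear_combination ι (gen .αs) * hc
  · linear_combination ι (gen .β) * hc
  · linear_combination 2 * c * ι (gen .βs) * hv' + ι (gen .βs) * hc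
  · linear_combination -(c ^ 2 * v * h) - c * (1 - ι (gen .x)) * hv' + ι (gen .x) * hc

/-- Naturality matches the section over the localized `O(S^4)` with the one over the localized
`O(S^7)`, in which the translation takes its coefficients. -/
theorem comp_northSection {R' : Type*} [CommRing R'] [Algebra ℂ R'] (φ : R →ₐ[ℂ] R')
    (ι : OS4 →ₐ[ℂ] R) (v : R) (hv : ι north * v = 1) :
    φ.comp (northSection ι v hv) = northSection (φ.comp ι) (φ v)
      (by rw [AlgHom.comp_apply, ← map_mul, hv, map_one]) := by
  apply OSphere.algHom_ext <;> intro i <;> fin_cases i <;> simp [northSection]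

/-- The section of the Hopf map where `(1 - x) / 2` is invertible. -/
def southSection (ι : OS4 →ₐ[ℂ] R) (v : R) (hv : ι south * v = 1) : OS7 →ₐ[ℂ] R :=
  OSphere.lift
    ![algebraMap ℂ R (1 / 2) * ι (gen .α), algebraMap ℂ R (1 / 2) * ι (gen .β), ι south, 0]
    ![algebraMap ℂ R (1 / 2) * ι (gen .αs) * v, algebraMap ℂ R (1 / 2) * ι (gen .βs) * v,
      1, 0] (by
    have h := map_relation ι
    have hc := two_mul_half R
    rw [map_south] at hv
    simp only [Fin.sum_univ_four, map_south, Matrix.cons_val_zero, Matrix.cons_val_one,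
      Matrix.cons_val]
    generalize algebraMap ℂ R (1 / 2) = c at *
    linear_combination c ^ 2 * v * h + c * (1 + ι (gen .x)) * hv + hc)

theorem southSection_hopf (ι : OS4 →ₐ[ℂ] R) (v : R) (hv : ι south * v = 1) :
    (southSection ι v hv).comp hopf = ι := by
  have h := map_relation ι
  have hc := two_mul_half R
  have hv' := hv
  rw [map_south] at hv'
  apply algHom_ext
  intro i
  cases i <;>
    simp only [hopf, hopfGen, southSection, map_south, AlgHom.comp_apply, lift_gen, map_add,
      map_sub, map_mul, map_ofNat, lift_z, lift_zs, Matrix.cons_val_zero, Matrix.cons_val_one,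
      Matrix.cons_val] <;>
    generalize algebraMap ℂ R (1 / 2) = c at *
  · linear_combination ι (gen .α) * hc
  · linear_combination 2 * c * ι (gen .αs) * hv' + ι (gen .αs) * hc
  · linear_combination ι (gen .β) * hc
  · linear_combination 2 * c * ι (gen .βs) * hv' + ι (gen .βs) * hc
  · linear_combination c ^ 2 * v * h + c * (1 + ι (gen .x)) * hv' + ι (gen .x) * hc

theorem comp_southSection {R' : Type*} [CommRing R'] [Algebra ℂ R'] (φ : R →ₐ[ℂ] R')
    (ι : OS4 →ₐ[ℂ] R) (v : R) (hv : ι south * v = 1) :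
    φ.comp (southSection ι v hv) = southSection (φ.comp ι) (φ v)
      (by rw [AlgHom.comp_apply, ← map_mul, hv, map_one]) := by
  apply OSphere.algHom_ext <;> intro i <;> fin_cases i <;> simp [southSection]

theorem hopf_gen (i : S4Gen) : hopf (gen i) = hopfGen i := by simp [hopf]

theorem hopf_north : hopf north = z 0 * zs 0 + z 1 * zs 1 := by
  rw [map_north, hopf_gen, hopfGen]
  have hc := two_mul_half OS7
  generalize algebraMap ℂ OS7 (1 / 2) = c at *
  linear_combination -c * OS7.rel + (z 0 * zs 0 + z 1 * zs 1) * hc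

theorem hopf_south : hopf south = z 2 * zs 2 + z 3 * zs 3 := by
  rw [map_south, hopf_gen, hopfGen]
  have hc := two_mul_half OS7
  generalize algebraMap ℂ OS7 (1 / 2) = c at *
  linear_combination -c * OS7.rel + (z 2 * zs 2 + z 3 * zs 3) * hc

/-- Where `(1 + x) / 2` is invertible, every point of the fibre is translated into the section by
an element of `SU(2)`. -/
theorem exists_northTranslation (ι : OS7 →ₐ[ℂ] R) (v : R) (hv : ι (hopf north) * v = 1) :
    ∃ γ : OSU2 →ₐ[ℂ] R, (Algebra.TensorProduct.productMap ι γ).comp deltaHom =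
      northSection (ι.comp hopf) v hv := by
  have hp := hv
  rw [hopf_north, map_add, map_mul, map_mul] at hp
  have hc := two_mul_half R
  have h2 : ι 2 = 2 := map_ofNat ι 2
  -- The matrix `γ(W)` is the inverse of the upper `2 × 2` block of `u` times `diag(p, 1)`, where
  -- `p` is the image of `hopf north`, the determinant of the block; it therefore has determinant
  -- one and carries the block to `diag(p, 1)`, as in the section.
  refine ⟨OSphere.lift ![ι (zs 0), -ι (z 1)] ![ι (z 0) * v, -ι (zs 1) * v]
    (by simp only [Fin.sum_univ_two, Matrix.cons_val_zero, Matrix.cons_val_one]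
        linear_combination hp), ?_⟩
  apply OSphere.algHom_ext <;> intro i <;> fin_cases i <;>
    simp [deltaHom, northSection, hopf_north, hopf_gen, hopfGen] <;>
    rw [one_div] at hc <;>
    generalize algebraMap ℂ R 2⁻¹ = c at *
  · ring
  · ring
  · linear_combination -(c * (ι (zs 0) * ι (z 2) + ι (z 1) * ι (zs 3))) * h2 -
      (ι (zs 0) * ι (z 2) + ι (z 1) * ι (zs 3)) * hc
  · linear_combination (c * (ι (z 1) * ι (zs 2) - ι (zs 0) * ι (z 3))) * h2 +
      (ι (z 1) * ι (zs 2) - ι (zs 0) * ι (z 3)) * hc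
  · linear_combination hp
  · ring
  · linear_combination -(c * (ι (z 0) * ι (zs 2) + ι (zs 1) * ι (z 3)) * v) * h2 -
      (ι (z 0) * ι (zs 2) + ι (zs 1) * ι (z 3)) * v * hc
  · linear_combination (c * (ι (zs 1) * ι (z 2) - ι (z 0) * ι (zs 3)) * v) * h2 +
      (ι (zs 1) * ι (z 2) - ι (z 0) * ι (zs 3)) * v * hc

/-- Where `(1 - x) / 2` is invertible, every point of the fibre is translated into the section by
an element of `SU(2)`. -/
theorem exists_southTranslation (ι : OS7 →ₐ[ℂ] R) (v : R) (hv : ι (hopf south) * v = 1) :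
    ∃ γ : OSU2 →ₐ[ℂ] R, (Algebra.TensorProduct.productMap ι γ).comp deltaHom =
      southSection (ι.comp hopf) v hv := by
  have hp := hv
  rw [hopf_south, map_add, map_mul, map_mul] at hp
  have hc := two_mul_half R
  have h2 : ι 2 = 2 := map_ofNat ι 2
  -- The same construction with the lower `2 × 2` block of `u`, whose determinant is `hopf south`.
  refine ⟨OSphere.lift ![ι (zs 2), -ι (z 3)] ![ι (z 2) * v, -ι (zs 3) * v]
    (by simp only [Fin.sum_univ_two, Matrix.cons_val_zero, Matrix.cons_val_one]
        linear_combination hp), ?_⟩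
  apply OSphere.algHom_ext <;> intro i <;> fin_cases i <;>
    simp [deltaHom, southSection, hopf_south, hopf_gen, hopfGen] <;>
    rw [one_div] at hc <;>
    generalize algebraMap ℂ R 2⁻¹ = c at *
  · linear_combination -(c * (ι (z 0) * ι (zs 2) + ι (zs 1) * ι (z 3))) * h2 -
      (ι (z 0) * ι (zs 2) + ι (zs 1) * ι (z 3)) * hc
  · linear_combination -(c * (ι (z 1) * ι (zs 2) - ι (zs 0) * ι (z 3))) * h2 -
      (ι (z 1) * ι (zs 2) - ι (zs 0) * ι (z 3)) * hc
  · ring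
  · ring
  · linear_combination -(c * (ι (zs 0) * ι (z 2) + ι (z 1) * ι (zs 3)) * v) * h2 -
      (ι (zs 0) * ι (z 2) + ι (z 1) * ι (zs 3)) * v * hc
  · linear_combination -(c * (ι (zs 1) * ι (z 2) - ι (z 0) * ι (zs 3)) * v) * h2 -
      (ι (zs 1) * ι (z 2) - ι (z 0) * ι (zs 3)) * v * hc
  · linear_combination hp
  · ring

/-- The consequences, over the open set where `p` is invertible, of a section of the Hopf map over
it: the Hopf map is injective, and its image contains the coinvariants, up to powers of `p`. -/
theorem chart (p : OS4) (s : OS7 →ₐ[ℂ] Localization.Away p)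
    (hs : s.comp hopf = Algebra.algHom ℂ OS4 (Localization.Away p)) :
    (∀ b, hopf b = 0 → ∃ N : ℕ, p ^ N * b = 0) ∧
    ∀ (φ : Localization.Away p →ₐ[ℂ] Localization.Away (hopf p))
      (_ : φ.comp (Algebra.algHom ℂ OS4 (Localization.Away p)) =
        (Algebra.algHom ℂ OS7 (Localization.Away (hopf p))).comp hopf)
      (γ : OSU2 →ₐ[ℂ] Localization.Away (hopf p))
      (_ : (Algebra.TensorProduct.productMap
        (Algebra.algHom ℂ OS7 (Localization.Away (hopf p))) γ).comp deltaHom = φ.comp s)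
      (f : OS7), deltaHom f = f ⊗ₜ 1 → ∃ (N : ℕ) (b : OS4), hopf (p ^ N) * f = hopf b := by
  constructor
  · intro b hb
    have h := DFunLike.congr_fun hs b
    rw [AlgHom.comp_apply, hb, map_zero] at h
    obtain ⟨⟨_, N, rfl⟩, hN⟩ := (IsLocalization.map_eq_zero_iff (Submonoid.powers p)
      (Localization.Away p) b).1 h.symm
    exact ⟨N, hN⟩
  · intro φ hφ γ hγ f hf
    -- A coinvariant `f` is unchanged by the translation, so in the localization it equals `φ (s
    -- f)`, which is pulled back from the base. Clearing denominators twice, once in each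
    -- localization, gives the two exponents.
    have h := DFunLike.congr_fun hγ f
    rw [AlgHom.comp_apply, hf, Algebra.TensorProduct.productMap_apply_tmul, map_one, mul_one,
      AlgHom.comp_apply] at h
    obtain ⟨⟨b, ⟨_, N, rfl⟩⟩, hb⟩ := IsLocalization.surj (Submonoid.powers p) (s f)
    have hφ' (a : OS4) : φ (algebraMap OS4 (Localization.Away p) a) =
        algebraMap OS7 (Localization.Away (hopf p)) (hopf a) := DFunLike.congr_fun hφ a
    have h1 := congrArg φ hb
    rw [map_mul, hφ', hφ', ← h] at h1
    have h2 : algebraMap OS7 (Localization.Away (hopf p)) (f * hopf (p ^ N)) =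
        algebraMap OS7 (Localization.Away (hopf p)) (hopf b) := by
      rw [map_mul]; exact h1
    obtain ⟨⟨_, M, rfl⟩, hM⟩ := (IsLocalization.eq_iff_exists (Submonoid.powers (hopf p))
      (Localization.Away (hopf p))).1 h2
    refine ⟨M + N, p ^ M * b, ?_⟩
    dsimp only at hM
    rw [map_mul, map_pow, map_pow hopf p M, ← hM, map_pow]
    ring

/-- The map of localizations induced by the Hopf map. -/
theorem exists_localizationMap (p : OS4) :
    ∃ φ : Localization.Away p →ₐ[ℂ] Localization.Away (hopf p),
      φ.comp (Algebra.algHom ℂ OS4 (Localization.Away p)) =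
        (Algebra.algHom ℂ OS7 (Localization.Away (hopf p))).comp hopf := by
  refine ⟨IsLocalization.liftAlgHom (M := Submonoid.powers p)
    (f := (Algebra.algHom ℂ OS7 (Localization.Away (hopf p))).comp hopf) ?_, ?_⟩
  · rintro ⟨_, N, rfl⟩
    have : IsUnit (algebraMap OS7 (Localization.Away (hopf p)) (hopf p)) :=
      IsLocalization.Away.algebraMap_isUnit (hopf p)
    rw [map_pow]
    exact this.pow N
  · ext b
    exact IsLocalization.lift_eq _ b

theorem north_chart :
    (∀ b, hopf b = 0 → ∃ N : ℕ, north ^ N * b = 0) ∧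
    ∀ f : OS7, deltaHom f = f ⊗ₜ 1 → ∃ (N : ℕ) (b : OS4), hopf (north ^ N) * f = hopf b := by
  have hv : Algebra.algHom ℂ OS4 (Localization.Away north) north *
      IsLocalization.Away.invSelf north = 1 := IsLocalization.Away.mul_invSelf north
  obtain ⟨φ, hφ⟩ := exists_localizationMap north
  obtain ⟨h1, h2⟩ := chart north (northSection _ _ hv) (northSection_hopf _ _ hv)
  refine ⟨h1, ?_⟩
  have hv' : Algebra.algHom ℂ OS7 (Localization.Away (hopf north)) (hopf north) *
      φ (IsLocalization.Away.invSelf north) = 1 := by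
    have := congrArg φ hv
    rw [map_mul, map_one] at this
    rw [← this]
    exact congrArg (· * _) (DFunLike.congr_fun hφ north).symm
  obtain ⟨γ, hγ⟩ := exists_northTranslation _ _ hv'
  refine h2 φ hφ γ ?_
  rw [hγ, comp_northSection]
  simp only [hφ]

theorem south_chart :
    (∀ b, hopf b = 0 → ∃ N : ℕ, south ^ N * b = 0) ∧
    ∀ f : OS7, deltaHom f = f ⊗ₜ 1 → ∃ (N : ℕ) (b : OS4), hopf (south ^ N) * f = hopf b := by
  have hv : Algebra.algHom ℂ OS4 (Localization.Away south) south *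
      IsLocalization.Away.invSelf south = 1 := IsLocalization.Away.mul_invSelf south
  obtain ⟨φ, hφ⟩ := exists_localizationMap south
  obtain ⟨h1, h2⟩ := chart south (southSection _ _ hv) (southSection_hopf _ _ hv)
  refine ⟨h1, ?_⟩
  have hv' : Algebra.algHom ℂ OS7 (Localization.Away (hopf south)) (hopf south) *
      φ (IsLocalization.Away.invSelf south) = 1 := by
    have := congrArg φ hv
    rw [map_mul, map_one] at this
    rw [← this]
    exact congrArg (· * _) (DFunLike.congr_fun hφ south).symm
  obtain ⟨γ, hγ⟩ := exists_southTranslation _ _ hv'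
  refine h2 φ hφ γ ?_
  rw [hγ, comp_southSection]
  simp only [hφ]

/-- An element of the kernel is killed by a power of `north` and by a power of `south`, and these
powers generate the unit ideal. -/
theorem hopf_injective : Function.Injective hopf := by
  rw [injective_iff_map_eq_zero]
  intro b hb
  obtain ⟨N, hN⟩ := north_chart.1 b hb
  obtain ⟨M, hM⟩ := south_chart.1 b hb
  obtain ⟨u, v, huv⟩ := isCoprime_pow N M
  linear_combination -b * huv + u * hN + v * hM

/-- The local preimages, valid up to powers of `north` and `south`, are combined with the
coefficients of a Bézout relation between these powers. -/
theorem exists_hopf_eq (f : OS7) (hf : deltaHom f = f ⊗ₜ 1) : ∃ b, hopf b = f := by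
  obtain ⟨N, b, hb⟩ := north_chart.2 f hf
  obtain ⟨M, c, hc⟩ := south_chart.2 f hf
  obtain ⟨u, v, huv⟩ := isCoprime_pow N M
  refine ⟨u * b + v * c, ?_⟩
  have h := congrArg hopf huv
  rw [map_add, map_mul, map_mul, map_one] at h
  rw [map_add, map_mul, map_mul, ← hb, ← hc]
  linear_combination f * h

/-- Up to the factor `2`, the images of `α`, `β` and their adjoints are entries of `u u^*`, and that
of `x` is a difference of two diagonal entries. Moreover `δ(u u^*) = u W W^* u^* = u u^*`, which
reduces to the single relation `hr`. -/
theorem deltaHom_hopf (b : OS4) : deltaHom (hopf b) = hopf b ⊗ₜ 1 := by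
  have h : deltaHom.comp hopf =
      (Algebra.TensorProduct.includeLeft : OS7 →ₐ[ℂ] OS7 ⊗[ℂ] OSU2).comp hopf := by
    have hr : ((1 : OS7) ⊗ₜ[ℂ] (zs 0 : OSU2)) * (1 ⊗ₜ z 0) + (1 ⊗ₜ zs 1) * (1 ⊗ₜ z 1) = 1 := by
      simp only [Algebra.TensorProduct.tmul_mul_tmul, one_mul]
      rw [← TensorProduct.tmul_add, OSU2.rel, Algebra.TensorProduct.one_def]
    have h2 : (2 : OS7) ⊗ₜ[ℂ] (1 : OSU2) = 2 := rfl
    have hd2 : deltaHom 2 = 2 := map_ofNat deltaHom 2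
    -- Writing each `a ⊗ c` as `(a ⊗ 1) * (1 ⊗ c)` turns the check into polynomial arithmetic in the
    -- commutative ring `OS7 ⊗ OSU2`.
    have hz0 : deltaHom (z 0) = (z 0 ⊗ₜ 1) * (1 ⊗ₜ z 0) - (zs 1 ⊗ₜ 1) * (1 ⊗ₜ z 1) := by
      simp [deltaHom]
    have hz1 : deltaHom (z 1) = (z 1 ⊗ₜ 1) * (1 ⊗ₜ z 0) + (zs 0 ⊗ₜ 1) * (1 ⊗ₜ z 1) := by
      simp [deltaHom]
    have hz2 : deltaHom (z 2) = (z 2 ⊗ₜ 1) * (1 ⊗ₜ z 0) - (zs 3 ⊗ₜ 1) * (1 ⊗ₜ z 1) := by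
      simp [deltaHom]
    have hz3 : deltaHom (z 3) = (z 3 ⊗ₜ 1) * (1 ⊗ₜ z 0) + (zs 2 ⊗ₜ 1) * (1 ⊗ₜ z 1) := by
      simp [deltaHom]
    have hs0 : deltaHom (zs 0) = (zs 0 ⊗ₜ 1) * (1 ⊗ₜ zs 0) - (z 1 ⊗ₜ 1) * (1 ⊗ₜ zs 1) := by
      simp [deltaHom]
    have hs1 : deltaHom (zs 1) = (zs 1 ⊗ₜ 1) * (1 ⊗ₜ zs 0) + (z 0 ⊗ₜ 1) * (1 ⊗ₜ zs 1) := by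
      simp [deltaHom]
    have hs2 : deltaHom (zs 2) = (zs 2 ⊗ₜ 1) * (1 ⊗ₜ zs 0) - (z 3 ⊗ₜ 1) * (1 ⊗ₜ zs 1) := by
      simp [deltaHom]
    have hs3 : deltaHom (zs 3) = (zs 3 ⊗ₜ 1) * (1 ⊗ₜ zs 0) + (z 2 ⊗ₜ 1) * (1 ⊗ₜ zs 1) := by
      simp [deltaHom]
    apply algHom_ext
    intro i
    cases i <;>
      simp only [AlgHom.comp_apply, hopf_gen, hopfGen, Algebra.TensorProduct.includeLeft_apply,
        map_add, map_sub, map_mul, hd2, h2, hz0, hz1, hz2, hz3, hs0, hs1, hs2, hs3]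
    · linear_combination 2 * ((z 0 ⊗ₜ 1) * (zs 2 ⊗ₜ 1) + (zs 1 ⊗ₜ 1) * (z 3 ⊗ₜ 1)) * hr
    · linear_combination 2 * ((zs 0 ⊗ₜ 1) * (z 2 ⊗ₜ 1) + (z 1 ⊗ₜ 1) * (zs 3 ⊗ₜ 1)) * hr
    · linear_combination 2 * ((z 1 ⊗ₜ 1) * (zs 2 ⊗ₜ 1) - (zs 0 ⊗ₜ 1) * (z 3 ⊗ₜ 1)) * hr
    · linear_combination 2 * ((zs 1 ⊗ₜ 1) * (z 2 ⊗ₜ 1) - (z 0 ⊗ₜ 1) * (zs 3 ⊗ₜ 1)) * hr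
    · linear_combination ((z 0 ⊗ₜ 1) * (zs 0 ⊗ₜ 1) + (z 1 ⊗ₜ 1) * (zs 1 ⊗ₜ 1) -
        (z 2 ⊗ₜ 1) * (zs 2 ⊗ₜ 1) - (z 3 ⊗ₜ 1) * (zs 3 ⊗ₜ 1)) * hr
  exact DFunLike.congr_fun h b

end Charts

end OS4

/-! ### Transfer of the classical statements to the twisted algebras. -/

theorem hopfθ_injective (θ : ℝ) : Function.Injective (hopfθ θ) :=
  OS4.hopf_injective

/-- Coinvariance is a linear condition on an unchanged coaction, so it is insensitive to the twist.
-/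
theorem mem_coinvariants_deltaθ (θ : ℝ) (f : OS7) :
    Twisted.of (sigma θ) rho f ∈ (deltaθ θ).coinvariants ↔ deltaHom f = f ⊗ₜ 1 := by
  rw [RightCoaction.mem_coinvariants, deltaθ, RightCoaction.twist_of]
  have hinj : Function.Injective (TensorProduct.map (Twisted.of (sigma θ) rho).toLinearMap
      (LinearMap.id : OSU2 →ₗ[ℂ] OSU2)) :=
    (TensorProduct.congr (Twisted.of (sigma θ) rho) (LinearEquiv.refl ℂ OSU2)).injective
  have h1 : Twisted.of (sigma θ) rho f ⊗ₜ[ℂ] (1 : OSU2) =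
      TensorProduct.map (Twisted.of (sigma θ) rho).toLinearMap LinearMap.id (f ⊗ₜ 1) := by simp
  rw [h1, hinj.eq_iff]
  rfl

theorem range_hopfθ (θ : ℝ) : (hopfθ θ).range = (deltaθ θ).coinvariants := by
  apply le_antisymm
  · rintro _ ⟨b, rfl⟩
    obtain ⟨b, rfl⟩ := (Twisted.of (sigma θ) OS4.rho).surjective b
    exact (mem_coinvariants_deltaθ θ _).2 (OS4.deltaHom_hopf b)
  · intro f hf
    obtain ⟨f, rfl⟩ := (Twisted.of (sigma θ) rho).surjective f
    obtain ⟨b, rfl⟩ := OS4.exists_hopf_eq f ((mem_coinvariants_deltaθ θ f).1 hf)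
    exact ⟨Twisted.of (sigma θ) OS4.rho b, rfl⟩

end QuantumHopf

end

theorem proposition3p15 (θ : ℝ) :
    (QuantumHopf.deltaθ θ).IsPrincipal ∧
      Function.Injective (QuantumHopf.hopfθ θ) ∧
      (QuantumHopf.hopfθ θ).range = (QuantumHopf.deltaθ θ).coinvariants := by
  exact ⟨QuantumHopf.deltaθ_isPrincipal θ, QuantumHopf.hopfθ_injective θ,
    QuantumHopf.range_hopfθ θ⟩
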